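/- Let $n\ge 2$, and let $\mathfrak c_{n-1}$ be the complex hyperbolic metric of constant holomorphic sectional curvature $-4$ on the open unit ball $B\subset\mathbb C^{n-1}$, that is $$\mathfrak c_{n-1}(u,w)=\operatorname{Re}\Big(\frac{\langle u,w\rangle}{1-|z|^2}+\frac{\langle u,z\rangle\langle z,w\rangle}{(1-|z|^2)^2}\Big)\quad\text{at } z\in B .$$ Let $h,v:(0,\infty)\to(0,\infty)$ be smooth. On $B\times S^1\times(0,\infty)$, with coordinates $(z,\theta,r)$, fix a horizontal distribution that projects isomorphically onto $TB$, is annihilated by $dr$ and is invariant under $\theta$ and $r$; equivalently, it is the common kernel of $dr$ and of $d\theta+\beta$ for a smooth one-form $\beta$ on $B$ (only a neighbourhood of the point $p$ below matters). Put $$\mu=h^2\,\mathfrak c_{n-1}+\tfrac14 v^2\,d\theta^2+dr^2,$$ where $d\theta$ in this formula stands for the one-form $d\theta+\beta$ that vanishes on horizontal vectors. Let $p\in B$ and let $q=(p,\theta,r)$ with $r>0$. Let $\check X_1,\dots,\check X_{2n-2}$ be smooth vector fields near $p$ that are orthonormal for $\mathfrak c_{n-1}$ near $p$, satisfy $\check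 X_{i+1}=J\check X_i$ at $p$ for $i$ odd, and satisfy $[\check X_i,\check X_j]_p=0$ for all $i,j$ (a holomorphic frame). Let $X_i$ be the horizontal lift of $\check X_i$, and assume that the $X_i$ have structure constants $c_i$ at $q$: for $i$ odd $[X_i,X_{i+1}]_q=c_i\,\partial/\partial\theta$, and $[X_i,X_j]_q=0$ whenever $\{i,j\}$ is not of the form $\{k,k+1\}$ with $k$ odd. Put $c_{i+1}:=c_i$ for $i$ odd. Let $$Y_i=\tfrac1h X_i\ (1\le i\le 2n-2),\qquad Y_{2n-1}=\frac{1}{\frac12 v}\frac{\partial}{\partial\theta},\qquad Y_{2n}=\frac{\partial}{\partial r},$$ and let $R_{a,b,c,d}=\mu(R_\mu(Y_a,Y_b)Y_c,Y_d)$ at $q$, where $R_\mu$ is the curvature tensor of $\mu$ with the sign for which $R_{a,b,a,b}$ is the sectional curvature of the plane spanned by $Y_a,Y_b$. Then $(Y_a)$ is $\mu$-orthonormal at $q$, the components satisfy $R_{b,a,c,d}=R_{a,b,d,c}=-R_{a,b,c,d}$ and $R_{c,d,a,b}=R_{a,b,c,d}$, and the following hold, with $h,v$ and their derivatives evaluated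 at $r$. For $1\le i,j\le 2n-2$ such that $i\ne j$ and $\{i,j\}\neq\{k,k+1\}$ for every odd $k$: $$R_{i,j,i,j}=-\frac1{h^2}-\Big(\frac{h'}h\Big)^2 .$$ For $1\le i\le 2n-2$: $$R_{i,2n-1,i,2n-1}=-\frac{h'v'}{hv}+\frac{c_i^2v^2}{16h^4},\qquad R_{i,2n,i,2n}=-\frac{h''}{h},\qquad R_{2n-1,2n,2n-1,2n}=-\frac{v''}{v}.$$ For odd $i$ with $1\le i\le 2n-2$: $$R_{i,i+1,i,i+1}=-\Big(\frac{h'}h\Big)^2-\frac4{h^2}-\frac{3c_i^2v^2}{16h^4},$$ $$R_{i,i+1,2n-1,2n}=2R_{i,2n-1,i+1,2n}=-2R_{i,2n,i+1,2n-1}=-c_i\frac{v}{2h^2}\Big(\ln\frac vh\Big)' .$$ For distinct odd $i,k$ with $1\le i,k\le 2n-2$: $$R_{i,i+1,k,k+1}=2R_{i,k,i+1,k+1}=-2R_{i,k+1,i+1,k}=-\frac2{h^2}-\frac{c_ic_kv^2}{8h^4}.$$ Every component that is not related to one of these by the symmetries above is zero, except possibly those with three indices in $\{1,\dots,2n-2\}$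 and one index equal to $2n-1$. These vanish as well if the $\partial/\partial\theta$-coefficients of the brackets $[X_i,X_j]$, $1\le i,j\le 2n-2$, are constant to first order at $q$ (that is, have zero differential at $q$). -/

import Mathlib

open scoped ContDiff Topology

noncomputable section

/-! ### Levi-Civita connection and curvature of a metric in a linear chart -/

section Riemannian

variable {V : Type*} [NormedAddCommGroup V] [NormedSpace ℝ V]

/-- Christoffel symbol of the first kind of the metric `g`, contracted with three vectors:
`½ (∂_u g(w, y) + ∂_w g(u, y) - ∂_y g(u, w))` at the point `x`. -/
def christoffelFirst (g : V → V → V → ℝ) (x u w y : V) : ℝ :=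
  (1 / 2) * (fderiv ℝ (fun x' => g x' w y) x u + fderiv ℝ (fun x' => g x' u y) x w
    - fderiv ℝ (fun x' => g x' u w) x y)

open Classical in
/-- Christoffel symbol of the second kind: the vector `Γ_x(u, w)` with
`g_x(Γ_x(u, w), y) = christoffelFirst g x u w y` for every `y`. In finite dimension it exists and
is unique at each point where `g` is nondegenerate (elsewhere a default value is used). -/
def christoffel (g : V → V → V → ℝ) (x u w : V) : V :=
  if H : ∃ z : V, ∀ y : V, g x z y = christoffelFirst g x u w y then H.choose else 0

/-- The Levi-Civita covariant derivative `∇_X Y` of vector fields: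
`(∇_X Y)(x) = D Y(x)[X x] + Γ_x(X x, Y x)`. -/
def leviCivita (g : V → V → V → ℝ) (X Y : V → V) (x : V) : V :=
  fderiv ℝ Y x (X x) + christoffel g x (X x) (Y x)

/-- The curvature tensor `R(X, Y) Z = ∇_{[X, Y]} Z - ∇_X ∇_Y Z + ∇_Y ∇_X Z`. With this sign,
`g(R(X, Y) X, Y)` is the sectional curvature of the plane spanned by orthonormal `X`, `Y`. -/
def curvature (g : V → V → V → ℝ) (X Y Z : V → V) (x : V) : V :=
  leviCivita g (VectorField.lieBracket ℝ X Y) Z x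
    - (leviCivita g X (leviCivita g Y Z) x - leviCivita g Y (leviCivita g X Z) x)

end Riemannian

/-! ### Complex hyperbolic space and the metric `μ`. Throughout, `m = n - 1`. -/

/-- The coordinate space `ℂᵐ`; complex hyperbolic space is its open unit ball. -/
abbrev CSpace (m : ℕ) : Type := EuclideanSpace ℂ (Fin m)

/-- The coordinate space of points `(z, θ, r)`. -/
abbrev TotalSpace (m : ℕ) : Type := CSpace m × ℝ × ℝ

/-- The complex hyperbolic metric of constant holomorphic sectional curvature `-4`, in the unit
ball model:
`Re (⟨u, w⟩ / (1 - |z|²) + ⟨u, z⟩ ⟨z, w⟩ / (1 - |z|²)²)`. -/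
def complexHyperbolicMetric {m : ℕ} (z u w : CSpace m) : ℝ :=
  (inner ℂ u w).re / (1 - ‖z‖ ^ 2) + (inner ℂ u z * inner ℂ z w).re / (1 - ‖z‖ ^ 2) ^ 2

/-- The angular one-form `dθ + β`; its kernel is spanned by `∂/∂r` and the horizontal
distribution. Here `β` is a one-form on the base. -/
def angularForm {m : ℕ} (β : CSpace m → CSpace m →L[ℝ] ℝ) (q u : TotalSpace m) : ℝ :=
  u.2.1 + β q.1 u.1

/-- The metric `μ = h² 𝔠 + ¼ v² dθ² + dr²`, where `𝔠` is evaluated on projections to the base and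
`dθ` means the angular one-form that vanishes on the horizontal distribution. -/
def muMetric {m : ℕ} (h v : ℝ → ℝ) (β : CSpace m → CSpace m →L[ℝ] ℝ)
    (q u w : TotalSpace m) : ℝ :=
  h q.2.2 ^ 2 * complexHyperbolicMetric q.1 u.1 w.1
    + (1 / 4) * v q.2.2 ^ 2 * (angularForm β q u * angularForm β q w) + u.2.2 * w.2.2

/-- The horizontal lift of a vector field on the base: it projects to that field, is annihilated
by `dθ + β` and by `dr`, and does not depend on `θ` and `r`. -/
def horizontalLift {m : ℕ} (β : CSpace m → CSpace m →L[ℝ] ℝ) (X : CSpace m → CSpace m)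
    (q : TotalSpace m) : TotalSpace m :=
  (X q.1, -(β q.1 (X q.1)), 0)

/-- The coordinate vector `∂/∂θ`. -/
def dTheta (m : ℕ) : TotalSpace m := (0, 1, 0)

/-- The coordinate vector `∂/∂r`. -/
def dR (m : ℕ) : TotalSpace m := (0, 0, 1)

/-! ### Frames -/

/-- Indices `1, …, 2m` of a frame of the base: `(a, false)` is the odd index `2a + 1` and
`(a, true)` is the even index `2a + 2`, for `a = 0, …, m - 1`. -/
abbrev BaseIndex (m : ℕ) : Type := Fin m × Bool

/-- Indices `1, …, 2n` of a frame of the total space: the base indices, then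
`Sum.inr false` for `2n - 1` and `Sum.inr true` for `2n`. -/
abbrev FrameIndex (m : ℕ) : Type := BaseIndex m ⊕ Bool

namespace FrameIndex

/-- The horizontal index given by a base index. -/
abbrev hor {m : ℕ} (i : BaseIndex m) : FrameIndex m := Sum.inl i

/-- The odd index `i = 2a + 1`. -/
abbrev odd {m : ℕ} (a : Fin m) : FrameIndex m := Sum.inl (a, false)

/-- The even index `i + 1 = 2a + 2`. -/
abbrev even {m : ℕ} (a : Fin m) : FrameIndex m := Sum.inl (a, true)

/-- The index `2n - 1`, of the direction `∂/∂θ`. -/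
abbrev ang {m : ℕ} : FrameIndex m := Sum.inr false

/-- The index `2n`, of the direction `∂/∂r`. -/
abbrev rad {m : ℕ} : FrameIndex m := Sum.inr true

/-- The involution that exchanges `i` and `i + 1` for each odd `i` in `1, …, 2n`. -/
def partner {m : ℕ} : FrameIndex m → FrameIndex m
  | Sum.inl (a, s) => Sum.inl (a, !s)
  | Sum.inr s => Sum.inr (!s)

/-- The index patterns of the components that are given by explicit formulas, up to the symmetries
of a curvature tensor: `{a, b} = {c, d}`, or the four indices consist of two pairs of partners. -/
def IsListed {m : ℕ} (a b c d : FrameIndex m) : Prop :=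
  (c = a ∧ d = b) ∨ (c = b ∧ d = a) ∨ (b = partner a ∧ d = partner c) ∨
    (c = partner a ∧ d = partner b) ∨ (d = partner a ∧ c = partner b)

/-- Three of the four indices are horizontal and the fourth one is the index of `∂/∂θ`. -/
def IsThreeHorOneAng {m : ℕ} (a b c d : FrameIndex m) : Prop :=
  [a, b, c, d].count ang = 1 ∧ rad ∉ [a, b, c, d]

end FrameIndex

/-- The adapted frame: `Y_i = (1 / h) X_i` for the horizontal indices, where `X_i` is the
horizontal lift of the `i`-th field on the base, then `(1 / (v / 2)) ∂/∂θ` and `∂/∂r`. -/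
def adaptedFrame {m : ℕ} (h v : ℝ → ℝ) (β : CSpace m → CSpace m →L[ℝ] ℝ)
    (X : BaseIndex m → CSpace m → CSpace m) : FrameIndex m → TotalSpace m → TotalSpace m
  | Sum.inl i => fun q => (h q.2.2)⁻¹ • horizontalLift β (X i) q
  | Sum.inr false => fun q => ((1 / 2) * v q.2.2)⁻¹ • dTheta m
  | Sum.inr true => fun _ => dR m

/-- The component `R_{a,b,c,d} = μ(R_μ(Y_a, Y_b) Y_c, Y_d)` at the point `q`. -/
def curvComp {m : ℕ} (h v : ℝ → ℝ) (β : CSpace m → CSpace m →L[ℝ] ℝ)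
    (X : BaseIndex m → CSpace m → CSpace m) (q : TotalSpace m) (a b c d : FrameIndex m) : ℝ :=
  muMetric h v β q
    (curvature (muMetric h v β) (adaptedFrame h v β X a) (adaptedFrame h v β X b)
      (adaptedFrame h v β X c) q)
    (adaptedFrame h v β X d q)

/-- `X` is a holomorphic frame near the point `p` of the ball: smooth vector fields, orthonormal
near `p` for the complex hyperbolic metric, with `X_{i+1} = J X_i` at `p` for `i` odd, and with
all Lie brackets vanishing at `p`. -/
structure IsHolomorphicFrame {m : ℕ} (X : BaseIndex m → CSpace m → CSpace m)
    (p : CSpace m) : Prop where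
  smooth : ∀ i, ContDiffAt ℝ ∞ (X i) p
  orthonormal : ∀ᶠ z in 𝓝 p, ∀ i j,
    complexHyperbolicMetric z (X i z) (X j z) = if i = j then 1 else 0
  holomorphic_pair : ∀ a : Fin m, X (a, true) p = Complex.I • X (a, false) p
  lieBracket_eq_zero : ∀ i j, VectorField.lieBracket ℝ (X i) (X j) p = 0

/-- `c` is the family of structure constants at `q` of the horizontal lifts `X_i`:
`[X_i, X_{i+1}] = c_i ∂/∂θ` for `i` odd, and the brackets of all other pairs vanish. -/
structure HasStructureConstants {m : ℕ} (β : CSpace m → CSpace m →L[ℝ] ℝ)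
    (X : BaseIndex m → CSpace m → CSpace m) (q : TotalSpace m) (c : Fin m → ℝ) : Prop where
  pair : ∀ a : Fin m, VectorField.lieBracket ℝ (horizontalLift β (X (a, false)))
    (horizontalLift β (X (a, true))) q = c a • dTheta m
  not_pair : ∀ i j : BaseIndex m, i.1 ≠ j.1 →
    VectorField.lieBracket ℝ (horizontalLift β (X i)) (horizontalLift β (X j)) q = 0

/-- The `∂/∂θ`-coefficients of the brackets `[X_i, X_j]` (in the splitting into the horizontal
distribution, `∂/∂θ` and `∂/∂r`) are constant to first order at `q`. -/
def StructureConstantsStationary {m : ℕ} (β : CSpace m → CSpace m →L[ℝ] ℝ)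
    (X : BaseIndex m → CSpace m → CSpace m) (q : TotalSpace m) : Prop :=
  ∀ i j : BaseIndex m, HasFDerivAt (𝕜 := ℝ)
    (fun x => angularForm β x
      (VectorField.lieBracket ℝ (horizontalLift β (X i)) (horizontalLift β (X j)) x)) 0 q

end

/-! The metric has an explicit orthonormal frame with simple Lie brackets, and the curvature is read
off from these. In any orthonormal frame the inner products are constant, so Koszul's formula gives
the connection coefficients from the bracket coefficients alone (`inner_leviCivita`), and the
curvature is a polynomial in both together with first derivatives of the connection coefficients
along the frame (`curvature_frame`).

For the adapted frame (`bracketCoeff_eq`) the horizontal brackets have a base part, scaled by `1/h`,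
and an angular part `2α`, where `α` is a multiple of `dβ` on the base frame. Brackets with the
radial field only contribute `H = h'/h` and `W = v'/v`. The base fields commute at `p`, so the base
connection coefficients vanish there. Only their derivatives survive, in exactly the combination
that is the curvature of the base (`fderiv_connectionCoeff_sub`). That curvature is known in closed
form from the Christoffel symbols of the ball (`christoffel_ballMetric`, `curvature_ballMetric`).

The outcome resembles O'Neill's formulas. Horizontal components consist of `h⁻²` times the base
curvature, `-H²` terms and quadratic terms in `α`; mixed components are multiples of `(H - W) α`;
derivatives of `α` enter only with three horizontal indices and one angular index. The structure
constants say that `α` is `v/(4h²)` times `c_i` times the matrix of `J`, which turns each formula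
into the stated one.

For the vanishing statements, the curvature symmetries reduce to increasing pairs of indices
(`curvature_induction`). Apart from the exceptional type, each component is then zero or carries
Kronecker deltas or entries of `J` that are nonzero only on listed patterns, or is itself listed. -/

noncomputable section

open VectorField FrameIndex

/-! ### Connection and curvature in an orthonormal frame. -/

section FrameCurvature

variable {V : Type*} [NormedAddCommGroup V] [NormedSpace ℝ V]

/-- `Y` is a `C²` orthonormal frame, near `x`, of the symmetric bilinear form field `G`. -/
structure IsOrthonormalFrameAt {ι : Type*} [Fintype ι] [DecidableEq ι]
    (G : V → V →L[ℝ] V →L[ℝ] ℝ)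
    (Y : ι → V → V) (x : V) : Prop where
  symm : ∀ x u w, G x u w = G x w u
  contDiffAt_metric : ContDiffAt ℝ 2 G x
  contDiffAt : ∀ a, ContDiffAt ℝ 2 (Y a) x
  orthonormal : ∀ᶠ x' in 𝓝 x, ∀ a b, G x' (Y a x') (Y b x') = if a = b then 1 else 0
  card_eq : Fintype.card ι = Module.finrank ℝ V

/-- The metric as a function of three vectors. -/
abbrev formOf (G : V → V →L[ℝ] V →L[ℝ] ℝ) : V → V → V → ℝ := fun x u w => G x u w

/-- The components `G([Y_a, Y_b], Y_c)` of the Lie brackets of a frame. -/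
def bracketCoeff {ι : Type*} (G : V → V →L[ℝ] V →L[ℝ] ℝ) (Y : ι → V → V) (a b c : ι) (x : V) : ℝ :=
  G x (lieBracket ℝ (Y a) (Y b) x) (Y c x)

/-- The components `G(∇_{Y_a} Y_b, Y_c)` of the Levi-Civita connection in an orthonormal frame. -/
def connectionCoeff {ι : Type*} (G : V → V →L[ℝ] V →L[ℝ] ℝ) (Y : ι → V → V)
    (a b c : ι) (x : V) : ℝ :=
  (1 / 2) * (bracketCoeff G Y a b c x - bracketCoeff G Y b c a x + bracketCoeff G Y c a b x)

/-- The components of the curvature tensor of `G` in the frame `Y`. -/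
def curvatureCoeff {ι : Type*} (G : V → V →L[ℝ] V →L[ℝ] ℝ) (Y : ι → V → V) (x : V)
    (a b c d : ι) : ℝ :=
  G x (curvature (formOf G) (Y a) (Y b) (Y c) x) (Y d x)

lemma bracketCoeff_swap {ι : Type*} (G : V → V →L[ℝ] V →L[ℝ] ℝ) (Y : ι → V → V)
    (a b c : ι) (x : V) :
    bracketCoeff G Y b a c x = -bracketCoeff G Y a b c x := by
  rw [bracketCoeff, lieBracket_swap]
  simp [bracketCoeff]

lemma connectionCoeff_swap {ι : Type*} (G : V → V →L[ℝ] V →L[ℝ] ℝ) (Y : ι → V → V)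
    (a b c : ι) (x : V) :
    connectionCoeff G Y a c b x = -connectionCoeff G Y a b c x := by
  rw [connectionCoeff, connectionCoeff, bracketCoeff_swap G Y a b, bracketCoeff_swap G Y b c,
    bracketCoeff_swap G Y c a]
  ring

lemma leviCivita_congr {g : V → V → V → ℝ} {x : V} {A B B' : V → V} (h : B =ᶠ[𝓝 x] B') :
    leviCivita g A B x = leviCivita g A B' x := by
  simp only [leviCivita, h.fderiv_eq, h.eq_of_nhds]

variable {G : V → V →L[ℝ] V →L[ℝ] ℝ} {x : V}

lemma fderiv_clm_apply_const {F : Type*} [NormedAddCommGroup F] [NormedSpace ℝ F]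
    {T : V → V →L[ℝ] V →L[ℝ] F} {x : V} (hT : DifferentiableAt ℝ T x) (a b d : V) :
    fderiv ℝ (fun x' => T x' a b) x d = fderiv ℝ T x d a b := by
  have h1 : HasFDerivAt (fun x' => T x' a) ((fderiv ℝ T x).flip a) x := by
    simpa using hT.hasFDerivAt.clm_apply (hasFDerivAt_const a x)
  have h2 : HasFDerivAt (fun x' => T x' a b) (((fderiv ℝ T x).flip a).flip b) x := by
    simpa using h1.clm_apply (hasFDerivAt_const b x)
  rw [h2.fderiv]
  rfl

lemma christoffelFirst_formOf (hG : DifferentiableAt ℝ G x) (u w y : V) :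
    christoffelFirst (formOf G) x u w y
      = (1 / 2) * (fderiv ℝ G x u w y + fderiv ℝ G x w u y - fderiv ℝ G x y u w) := by
  simp only [christoffelFirst, formOf, fderiv_clm_apply_const hG]

lemma fderiv_metric_symm (symm : ∀ x u w, G x u w = G x w u) (hG : DifferentiableAt ℝ G x)
    (d u w : V) : fderiv ℝ G x d u w = fderiv ℝ G x d w u := by
  rw [← fderiv_clm_apply_const hG, ← fderiv_clm_apply_const hG]
  simp only [symm _ u w]

lemma fderiv_metric_apply (hG : DifferentiableAt ℝ G x) {A B : V → V}
    (hA : DifferentiableAt ℝ A x) (hB : DifferentiableAt ℝ B x) (u : V) :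
    fderiv ℝ (fun x' => G x' (A x') (B x')) x u
      = fderiv ℝ G x u (A x) (B x) + G x (fderiv ℝ A x u) (B x) + G x (A x) (fderiv ℝ B x u) := by
  have h1 := (hG.hasFDerivAt.clm_apply hA.hasFDerivAt).clm_apply hB.hasFDerivAt
  rw [h1.fderiv]
  simp
  ring

/-- If the form at `x` is nondegenerate, the vector `Γ_x(u, w)` is determined by its defining
property. -/
lemma christoffel_eq_of_forall (nondeg : ∀ z, (∀ y, G x z y = 0) → z = 0) {u w z : V}
    (hz : ∀ y, G x z y = christoffelFirst (formOf G) x u w y) :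
    christoffel (formOf G) x u w = z := by
  have H : ∃ z : V, ∀ y : V, formOf G x z y = christoffelFirst (formOf G) x u w y := ⟨z, hz⟩
  rw [christoffel, dif_pos H]
  rw [← sub_eq_zero]
  apply nondeg
  intro y
  have := H.choose_spec y
  simp only [formOf] at this
  rw [map_sub, sub_apply, hz, sub_eq_zero]
  exact this

namespace IsOrthonormalFrameAt

variable {ι : Type*} [Fintype ι] [DecidableEq ι] {Y : ι → V → V}

lemma eventually (hY : IsOrthonormalFrameAt G Y x) :
    ∀ᶠ x' in 𝓝 x, IsOrthonormalFrameAt G Y x' := by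
  have h1 := hY.contDiffAt_metric.eventually (by simp)
  have h2 : ∀ᶠ x' in 𝓝 x, ∀ a, ContDiffAt ℝ 2 (Y a) x' :=
    Filter.eventually_all.2 fun a => (hY.contDiffAt a).eventually (by simp)
  filter_upwards [h1, h2, hY.orthonormal.eventually_nhds] with x' a b c
  exact ⟨hY.symm, a, b, c, hY.card_eq⟩

lemma apply_eq (hY : IsOrthonormalFrameAt G Y x) (a b : ι) :
    G x (Y a x) (Y b x) = if a = b then 1 else 0 := hY.orthonormal.self_of_nhds a b

lemma differentiableAt_metric (hY : IsOrthonormalFrameAt G Y x) : DifferentiableAt ℝ G x :=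
  hY.contDiffAt_metric.differentiableAt (by simp)

lemma differentiableAt (hY : IsOrthonormalFrameAt G Y x) (a : ι) : DifferentiableAt ℝ (Y a) x :=
  (hY.contDiffAt a).differentiableAt (by simp)

lemma linearIndependent (hY : IsOrthonormalFrameAt G Y x) :
    LinearIndependent ℝ (fun a => Y a x) := by
  rw [Fintype.linearIndependent_iff]
  intro t ht b
  have : G x (∑ a, t a • Y a x) (Y b x) = 0 := by rw [ht]; simp
  simpa [map_sum, hY.apply_eq] using this

lemma sum_smul_eq [FiniteDimensional ℝ V] (hY : IsOrthonormalFrameAt G Y x) (y : V) :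
    ∑ e, G x y (Y e x) • Y e x = y := by
  have hs := hY.linearIndependent.span_eq_top_of_card_eq_finrank' hY.card_eq
  have hy : y ∈ Submodule.span ℝ (Set.range fun a => Y a x) := by rw [hs]; trivial
  obtain ⟨t, rfl⟩ := (Submodule.mem_span_range_iff_exists_fun ℝ).1 hy
  simp [map_sum, hY.apply_eq]

lemma ext [FiniteDimensional ℝ V] (hY : IsOrthonormalFrameAt G Y x) {y z : V}
    (h : ∀ e, G x y (Y e x) = G x z (Y e x)) : y = z := by
  rw [← hY.sum_smul_eq y, ← hY.sum_smul_eq z]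
  simp only [h]

/-- The first-kind symbol is linear in its last argument, so expanding that argument in the frame
yields an explicit representing vector. The choice in `christoffel` is therefore never the default
value where a frame exists, and nondegeneracy makes it equal to this vector. -/
lemma christoffel_spec [FiniteDimensional ℝ V] (hY : IsOrthonormalFrameAt G Y x) (u w y : V) :
    G x (christoffel (formOf G) x u w) y = christoffelFirst (formOf G) x u w y := by
  have hz : ∀ y, G x (∑ e, christoffelFirst (formOf G) x u w (Y e x) • Y e x) y
      = christoffelFirst (formOf G) x u w y := by
    intro y
    simp only [christoffelFirst_formOf hY.differentiableAt_metric]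
    conv_rhs => rw [← hY.sum_smul_eq y]
    simp only [map_sum, map_smul, sum_apply, smul_apply, smul_eq_mul, Finset.mul_sum,
      ← Finset.sum_add_distrib, ← Finset.sum_sub_distrib]
    refine Finset.sum_congr rfl fun e _ => ?_
    rw [hY.symm x (Y e x) y]
    ring
  rw [christoffel_eq_of_forall _ hz]
  · exact hz y
  · intro z h0
    exact hY.ext fun e => by simp [h0]

lemma christoffel_comm [FiniteDimensional ℝ V] (hY : IsOrthonormalFrameAt G Y x) (u w : V) :
    christoffel (formOf G) x u w = christoffel (formOf G) x w u := by
  refine hY.ext fun e => ?_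
  rw [hY.christoffel_spec, hY.christoffel_spec,
    christoffelFirst_formOf hY.differentiableAt_metric,
    christoffelFirst_formOf hY.differentiableAt_metric,
    fderiv_metric_symm hY.symm hY.differentiableAt_metric _ u w]
  ring

lemma christoffel_add_right [FiniteDimensional ℝ V] (hY : IsOrthonormalFrameAt G Y x)
    (u w w' : V) : christoffel (formOf G) x u (w + w')
      = christoffel (formOf G) x u w + christoffel (formOf G) x u w' := by
  refine hY.ext fun e => ?_
  simp only [map_add, add_apply, hY.christoffel_spec,
    christoffelFirst_formOf hY.differentiableAt_metric]
  ring

lemma christoffel_smul_right [FiniteDimensional ℝ V] (hY : IsOrthonormalFrameAt G Y x)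
    (t : ℝ) (u w : V) : christoffel (formOf G) x u (t • w)
      = t • christoffel (formOf G) x u w := by
  refine hY.ext fun e => ?_
  simp only [map_smul, smul_apply, hY.christoffel_spec,
    christoffelFirst_formOf hY.differentiableAt_metric, smul_eq_mul]
  ring

/-- The Levi-Civita connection in the direction of a vector. -/
lemma leviCivita_eq_sum [FiniteDimensional ℝ V] (hY : IsOrthonormalFrameAt G Y x)
    (A B : V → V) :
    leviCivita (formOf G) A B x
      = ∑ e, G x (A x) (Y e x) • leviCivita (formOf G) (Y e) B x := by
  simp only [leviCivita, smul_add, Finset.sum_add_distrib]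
  congr 1
  · conv_lhs => rw [← hY.sum_smul_eq (A x)]
    simp only [map_sum, map_smul]
  · simp only [hY.christoffel_comm _ (B x), ← hY.christoffel_smul_right]
    conv_lhs => rw [← hY.sum_smul_eq (A x)]
    -- `christoffel` is a plain function, not a bundled linear map, so additivity is extended to
    -- finite sums by hand.
    refine Finset.induction_on (Finset.univ : Finset ι) ?_ fun a s ha ih => ?_
    · simpa using hY.christoffel_smul_right 0 (B x) 0
    · rw [Finset.sum_insert ha, Finset.sum_insert ha, hY.christoffel_add_right, ih]

lemma leviCivita_add [FiniteDimensional ℝ V] (hY : IsOrthonormalFrameAt G Y x)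
    (A : V → V) {B B' : V → V} (hB : DifferentiableAt ℝ B x) (hB' : DifferentiableAt ℝ B' x) :
    leviCivita (formOf G) A (fun y => B y + B' y) x
      = leviCivita (formOf G) A B x + leviCivita (formOf G) A B' x := by
  simp only [leviCivita]
  rw [fderiv_fun_add hB hB', hY.christoffel_add_right]
  simp only [add_apply]
  abel

lemma leviCivita_smul [FiniteDimensional ℝ V] (hY : IsOrthonormalFrameAt G Y x)
    (A : V → V) {f : V → ℝ} {B : V → V} (hf : DifferentiableAt ℝ f x)
    (hB : DifferentiableAt ℝ B x) :
    leviCivita (formOf G) A (fun y => f y • B y) x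
      = fderiv ℝ f x (A x) • B x + f x • leviCivita (formOf G) A B x := by
  simp only [leviCivita]
  rw [fderiv_fun_smul hf hB, hY.christoffel_smul_right]
  simp only [add_apply, smul_apply, smul_add,
    ContinuousLinearMap.smulRight_apply]
  abel

lemma leviCivita_sum [FiniteDimensional ℝ V] (hY : IsOrthonormalFrameAt G Y x)
    (A : V → V) {f : ι → V → ℝ} (hf : ∀ e, DifferentiableAt ℝ (f e) x) :
    leviCivita (formOf G) A (fun y => ∑ e, f e y • Y e y) x
      = ∑ e, (fderiv ℝ (f e) x (A x) • Y e x + f e x • leviCivita (formOf G) A (Y e) x) := by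
  have aux : ∀ s : Finset ι, leviCivita (formOf G) A (fun y => ∑ e ∈ s, f e y • Y e y) x
      = ∑ e ∈ s, (fderiv ℝ (f e) x (A x) • Y e x
        + f e x • leviCivita (formOf G) A (Y e) x) := by
    intro s
    induction s using Finset.induction_on with
    | empty =>
      have := hY.christoffel_smul_right 0 (A x) 0
      simp only [zero_smul] at this
      simp [leviCivita, this]
    | insert a s ha ih =>
      simp only [Finset.sum_insert ha]
      rw [hY.leviCivita_add A ((hf a).fun_smul (hY.differentiableAt a))
        (DifferentiableAt.fun_sum fun e _ => (hf e).fun_smul (hY.differentiableAt e)), ih,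
        hY.leviCivita_smul A (hf a) (hY.differentiableAt a)]
  exact aux Finset.univ

lemma leviCivita_sub_swap [FiniteDimensional ℝ V] (hY : IsOrthonormalFrameAt G Y x)
    (A B : V → V) :
    leviCivita (formOf G) A B x - leviCivita (formOf G) B A x = lieBracket ℝ A B x := by
  simp only [leviCivita, lieBracket, hY.christoffel_comm (A x) (B x)]
  abel

lemma metric_compat [FiniteDimensional ℝ V] (hY : IsOrthonormalFrameAt G Y x)
    (A : V → V) {B D : V → V} (hB : DifferentiableAt ℝ B x) (hD : DifferentiableAt ℝ D x) :
    fderiv ℝ (fun x' => G x' (B x') (D x')) x (A x)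
      = G x (leviCivita (formOf G) A B x) (D x) + G x (B x) (leviCivita (formOf G) A D x) := by
  rw [fderiv_metric_apply hY.differentiableAt_metric hB hD, hY.symm x (B x) (leviCivita _ _ _ _)]
  simp only [leviCivita, map_add, add_apply, hY.christoffel_spec,
    christoffelFirst_formOf hY.differentiableAt_metric]
  rw [fderiv_metric_symm hY.symm hY.differentiableAt_metric (A x) (D x) (B x),
    hY.symm x (B x) (fderiv ℝ D x (A x))]
  ring

/-- Metric compatibility applied to inner products of frame fields, which are constant near `x` and
so have zero derivative. -/
lemma frame_compat [FiniteDimensional ℝ V] (hY : IsOrthonormalFrameAt G Y x) (a b c : ι) :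
    G x (leviCivita (formOf G) (Y a) (Y b) x) (Y c x)
      = -G x (leviCivita (formOf G) (Y a) (Y c) x) (Y b x) := by
  have h := hY.metric_compat (Y a) (hY.differentiableAt b) (hY.differentiableAt c)
  have h0 : (fun x' => G x' (Y b x') (Y c x')) =ᶠ[𝓝 x] fun _ => if b = c then 1 else 0 := by
    filter_upwards [hY.orthonormal] with x' hx' using hx' b c
  rw [h0.fderiv_eq, hY.symm x (Y b x)] at h
  simp at h
  linarith

/-- Koszul's formula without its derivative terms: absence of torsion writes each bracket as a
difference of covariant derivatives, and skewness in the last two indices cancels all but one of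
them. -/
lemma inner_leviCivita [FiniteDimensional ℝ V] (hY : IsOrthonormalFrameAt G Y x) (a b c : ι) :
    G x (leviCivita (formOf G) (Y a) (Y b) x) (Y c x) = connectionCoeff G Y a b c x := by
  simp only [connectionCoeff, bracketCoeff, ← hY.leviCivita_sub_swap, map_sub, sub_apply]
  have h1 := hY.frame_compat a b c
  have h2 := hY.frame_compat b a c
  have h3 := hY.frame_compat c a b
  linarith

lemma leviCivita_frame [FiniteDimensional ℝ V] (hY : IsOrthonormalFrameAt G Y x) (a b : ι) :
    leviCivita (formOf G) (Y a) (Y b) x = ∑ e, connectionCoeff G Y a b e x • Y e x := by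
  simp only [← hY.inner_leviCivita, hY.sum_smul_eq]

lemma contDiffAt_bracketCoeff (hY : IsOrthonormalFrameAt G Y x) (a b c : ι) :
    ContDiffAt ℝ 1 (bracketCoeff G Y a b c) x := by
  have h1 : ContDiffAt ℝ 1 (lieBracket ℝ (Y a) (Y b)) x :=
    (hY.contDiffAt a).lieBracket_vectorField (hY.contDiffAt b) (by norm_num)
  exact ((hY.contDiffAt_metric.of_le (by norm_num)).clm_apply h1).clm_apply
    ((hY.contDiffAt c).of_le (by norm_num))

lemma differentiableAt_connectionCoeff (hY : IsOrthonormalFrameAt G Y x) (a b c : ι) :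
    DifferentiableAt ℝ (connectionCoeff G Y a b c) x := by
  have h (a b c : ι) : DifferentiableAt ℝ (bracketCoeff G Y a b c) x :=
    (hY.contDiffAt_bracketCoeff a b c).differentiableAt (by simp)
  exact (((h a b c).sub (h b c a)).add (h c a b)).const_mul _

lemma leviCivita_leviCivita [FiniteDimensional ℝ V] (hY : IsOrthonormalFrameAt G Y x)
    (a b c d : ι) :
    G x (leviCivita (formOf G) (Y a) (leviCivita (formOf G) (Y b) (Y c)) x) (Y d x)
      = fderiv ℝ (connectionCoeff G Y b c d) x (Y a x)
        + ∑ e, connectionCoeff G Y b c e x * connectionCoeff G Y a e d x := by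
  have h0 : leviCivita (formOf G) (Y b) (Y c)
      =ᶠ[𝓝 x] fun y => ∑ e, connectionCoeff G Y b c e y • Y e y := by
    filter_upwards [hY.eventually] with y hy using hy.leviCivita_frame b c
  rw [leviCivita_congr h0,
    hY.leviCivita_sum (Y a) fun e => hY.differentiableAt_connectionCoeff b c e]
  simp only [Finset.sum_add_distrib, map_add, map_sum, map_smul, add_apply, sum_apply,
    smul_apply, smul_eq_mul, hY.apply_eq, hY.inner_leviCivita]
  simp

/-- The components of the curvature tensor in an orthonormal frame. -/
theorem curvature_frame [FiniteDimensional ℝ V] (hY : IsOrthonormalFrameAt G Y x)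
    (a b c d : ι) :
    curvatureCoeff G Y x a b c d
      = (∑ f, bracketCoeff G Y a b f x * connectionCoeff G Y f c d x)
        - fderiv ℝ (connectionCoeff G Y b c d) x (Y a x)
        - (∑ e, connectionCoeff G Y b c e x * connectionCoeff G Y a e d x)
        + fderiv ℝ (connectionCoeff G Y a c d) x (Y b x)
        + ∑ e, connectionCoeff G Y a c e x * connectionCoeff G Y b e d x := by
  simp only [curvatureCoeff, curvature, map_sub, sub_apply, hY.leviCivita_leviCivita]
  rw [hY.leviCivita_eq_sum (lieBracket ℝ (Y a) (Y b))]
  simp only [map_sum, map_smul, sum_apply, smul_apply, smul_eq_mul, hY.inner_leviCivita]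
  simp only [bracketCoeff]
  ring

lemma curvatureCoeff_swap_left [FiniteDimensional ℝ V] (hY : IsOrthonormalFrameAt G Y x)
    (a b c d : ι) : curvatureCoeff G Y x b a c d = -curvatureCoeff G Y x a b c d := by
  rw [hY.curvature_frame, hY.curvature_frame]
  simp only [bracketCoeff_swap G Y a b, neg_mul, Finset.sum_neg_distrib]
  ring

lemma curvatureCoeff_swap_right [FiniteDimensional ℝ V] (hY : IsOrthonormalFrameAt G Y x)
    (a b c d : ι) : curvatureCoeff G Y x a b d c = -curvatureCoeff G Y x a b c d := by
  rw [hY.curvature_frame, hY.curvature_frame]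
  have h (a : ι) : connectionCoeff G Y a d c = -connectionCoeff G Y a c d :=
    funext fun y => connectionCoeff_swap G Y a c d y
  have h' : ∀ a b, ∑ e, connectionCoeff G Y b d e x * connectionCoeff G Y a e c x
      = ∑ e, connectionCoeff G Y a c e x * connectionCoeff G Y b e d x := fun a b =>
    Finset.sum_congr rfl fun e _ => by
      rw [connectionCoeff_swap G Y b e d, connectionCoeff_swap G Y a c e]
      ring
  simp only [h, h', fderiv_neg, neg_apply, Pi.neg_apply, mul_neg, Finset.sum_neg_distrib]
  ring

/-- The first Bianchi identity. -/
lemma curvatureCoeff_cyclic [FiniteDimensional ℝ V] (hY : IsOrthonormalFrameAt G Y x)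
    (a b c d : ι) : curvatureCoeff G Y x a b c d + curvatureCoeff G Y x b c a d
      + curvatureCoeff G Y x c a b d = 0 := by
  have hdiff (b c : ι) : DifferentiableAt ℝ (leviCivita (formOf G) (Y b) (Y c)) x := by
    have h0 : leviCivita (formOf G) (Y b) (Y c)
        =ᶠ[𝓝 x] fun y => ∑ e, connectionCoeff G Y b c e y • Y e y := by
      filter_upwards [hY.eventually] with y hy using hy.leviCivita_frame b c
    exact (DifferentiableAt.fun_sum fun e _ =>
      (hY.differentiableAt_connectionCoeff b c e).fun_smul
        (hY.differentiableAt e)).congr_of_eventuallyEq h0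
  -- Absence of torsion used twice: the left side is the covariant derivative of `[Y_b, Y_c]` along
  -- `Y_a`, and exchanging the two fields costs a bracket. In the cyclic sum the connection terms
  -- cancel and a Jacobi sum of double brackets remains.
  have key (a b c : ι) :
      leviCivita (formOf G) (Y a) (leviCivita (formOf G) (Y b) (Y c)) x
        - leviCivita (formOf G) (Y a) (leviCivita (formOf G) (Y c) (Y b)) x
      = leviCivita (formOf G) (lieBracket ℝ (Y b) (Y c)) (Y a) x
        + lieBracket ℝ (Y a) (lieBracket ℝ (Y b) (Y c)) x := by
    have h0 : leviCivita (formOf G) (Y b) (Y c)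
        =ᶠ[𝓝 x] fun y => lieBracket ℝ (Y b) (Y c) y + leviCivita (formOf G) (Y c) (Y b) y := by
      filter_upwards [hY.eventually] with y hy
      rw [← hy.leviCivita_sub_swap, sub_add_cancel]
    have h1 : DifferentiableAt ℝ (lieBracket ℝ (Y b) (Y c)) x :=
      ContDiffAt.differentiableAt (n := 1) ((hY.contDiffAt b).lieBracket_vectorField
        (hY.contDiffAt c) (by norm_num)) (by simp)
    rw [leviCivita_congr h0, hY.leviCivita_add _ h1 (hdiff c b), ← hY.leviCivita_sub_swap (Y a)]
    abel
  have jac := leibniz_identity_lieBracket (𝕜 := ℝ) (n := 2) (by simp) (hY.contDiffAt a)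
    (hY.contDiffAt b) (hY.contDiffAt c)
  rw [lieBracket_swap (V := lieBracket ℝ (Y a) (Y b)),
    show lieBracket ℝ (Y a) (Y c) = -lieBracket ℝ (Y c) (Y a) from
      funext fun y => lieBracket_swap,
    show lieBracket ℝ (Y b) (-lieBracket ℝ (Y c) (Y a)) x
      = -lieBracket ℝ (Y b) (lieBracket ℝ (Y c) (Y a)) x by
        simp only [lieBracket, fderiv_neg, Pi.neg_apply, neg_apply, map_neg]; abel] at jac
  have h : curvature (formOf G) (Y a) (Y b) (Y c) x + curvature (formOf G) (Y b) (Y c) (Y a) x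
      + curvature (formOf G) (Y c) (Y a) (Y b) x = 0 := by
    simp only [curvature]
    linear_combination (norm := module) (-1 : ℝ) • key a b c - (1 : ℝ) • key b c a
      - (1 : ℝ) • key c a b - (1 : ℝ) • jac
  simp only [curvatureCoeff, ← add_apply, ← map_add, h]
  simp

/-- A formal consequence of the two skew symmetries and four instances of the first Bianchi identity
(the octahedron argument), hence pure linear arithmetic. -/
lemma curvatureCoeff_pair_swap [FiniteDimensional ℝ V] (hY : IsOrthonormalFrameAt G Y x)
    (a b c d : ι) : curvatureCoeff G Y x c d a b = curvatureCoeff G Y x a b c d := by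
  have s1 := hY.curvatureCoeff_swap_left
  have s2 := hY.curvatureCoeff_swap_right
  have e1 := hY.curvatureCoeff_cyclic a b c d
  have e2 := hY.curvatureCoeff_cyclic b c d a
  have e3 := hY.curvatureCoeff_cyclic c d a b
  have e4 := hY.curvatureCoeff_cyclic d a b c
  linarith [s2 b c a d, s2 c a b d, s2 a b c d, s2 c d a b, s2 d b a c, s2 d a c b,
    s1 a c b d, s1 d b a c, s1 a d b c, s1 d b c a, s1 a c d b, s1 a d c b, s2 b d a c, s2 a c b d,
    s2 a d b c, s2 b c d a, s1 b d c a, s1 c a d b, s1 b d a c, s1 c a b d]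

end IsOrthonormalFrameAt

end FrameCurvature

/-! ### Curvature from a field of Christoffel symbols. -/

section ChristoffelField

variable {V : Type*} [NormedAddCommGroup V] [NormedSpace ℝ V]

/-- The curvature tensor in terms of a differentiable field of Christoffel symbols. -/
theorem curvature_eq_of_christoffel {g : V → V → V → ℝ} {Γ : V → V →L[ℝ] V →L[ℝ] V} {x : V}
    (hg : ∀ᶠ y in 𝓝 x, ∀ u w, christoffel g y u w = Γ y u w) (hΓ : DifferentiableAt ℝ Γ x)
    {A B C : V → V} (hA : DifferentiableAt ℝ A x) (hB : DifferentiableAt ℝ B x)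
    (hC : ContDiffAt ℝ 2 C x) :
    curvature g A B C x
      = fderiv ℝ Γ x (B x) (A x) (C x) - fderiv ℝ Γ x (A x) (B x) (C x)
        + Γ x (B x) (Γ x (A x) (C x)) - Γ x (A x) (Γ x (B x) (C x)) := by
  have hC1 : DifferentiableAt ℝ C x := hC.differentiableAt (by simp)
  have hC2 : DifferentiableAt ℝ (fderiv ℝ C) x :=
    (hC.fderiv_right (m := 1) (by norm_num)).differentiableAt (by simp)
  have hsymm : IsSymmSndFDerivAt ℝ C x := hC.isSymmSndFDerivAt (by simp)
  -- The full expansion of an iterated covariant derivative. On antisymmetrizing, the second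
  -- derivatives of `C` cancel by symmetry, and the derivatives of `A` and `B` assemble into the
  -- bracket term.
  have key : ∀ {A D : V → V}, DifferentiableAt ℝ A x →
      leviCivita g D (leviCivita g A C) x
        = fderiv ℝ (fderiv ℝ C) x (D x) (A x) + fderiv ℝ C x (fderiv ℝ A x (D x))
          + (fderiv ℝ Γ x (D x) (A x) (C x) + Γ x (fderiv ℝ A x (D x)) (C x)
            + Γ x (A x) (fderiv ℝ C x (D x)))
          + Γ x (D x) (fderiv ℝ C x (A x) + Γ x (A x) (C x)) := by
    intro A D hA
    have h0 : leviCivita g A C =ᶠ[𝓝 x] fun y => fderiv ℝ C y (A y) + Γ y (A y) (C y) := by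
      filter_upwards [hg] with y hy
      rw [leviCivita, hy]
    have h1 := (hC2.hasFDerivAt.clm_apply hA.hasFDerivAt).add
      ((hΓ.hasFDerivAt.clm_apply hA.hasFDerivAt).clm_apply hC1.hasFDerivAt)
    rw [leviCivita_congr h0, leviCivita, hg.self_of_nhds]
    erw [h1.fderiv]
    simp
    abel
  rw [curvature, key hA, key hB, leviCivita, hg.self_of_nhds, hsymm.eq (A x) (B x)]
  simp only [lieBracket, map_sub, map_add, sub_apply]
  abel

end ChristoffelField

lemma ContDiffAt.smul_bilinear {V F F' : Type*} [NormedAddCommGroup V] [NormedSpace ℝ V]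
    [NormedAddCommGroup F] [NormedSpace ℝ F] [NormedAddCommGroup F'] [NormedSpace ℝ F']
    {n : ℕ∞ω} {x : V} {f : V → ℝ} {T : V → F →L[ℝ] F →L[ℝ] F'} (hf : ContDiffAt ℝ n f x)
    (hT : ContDiffAt ℝ n T x) : ContDiffAt ℝ n (fun y => f y • T y) x := by
  have h : (fun y => f y • T y)
      = fun y => (T y).comp (f y • ContinuousLinearMap.id ℝ F) := by
    ext y u w
    simp
  rw [h]
  exact hT.clm_comp (hf.smul contDiffAt_const)

/-! ### The complex hyperbolic ball: Christoffel symbols and curvature. -/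

section ComplexHyperbolic

variable {E : Type*} [NormedAddCommGroup E] [InnerProductSpace ℝ E]

local notation "⟪" u ", " w "⟫" => inner ℝ u w

/-- `J` is a complex structure compatible with the inner product. -/
structure IsHermitianStructure (J : E →L[ℝ] E) : Prop where
  apply_apply : ∀ u, J (J u) = -u
  inner_right : ∀ u w, ⟪u, J w⟫ = -⟪J u, w⟫

/-- The real inner product as a continuous bilinear map. -/
def realInnerCLM : E →L[ℝ] E →L[ℝ] ℝ :=
  (innerₗ E).mkContinuous₂ 1 fun u w => by
    simpa using norm_inner_le_norm (𝕜 := ℝ) u w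

@[simp] lemma realInnerCLM_apply (u w : E) : realInnerCLM u w = ⟪u, w⟫ := rfl

/-- The complex hyperbolic metric of the unit ball of a Hermitian space, as a field of bilinear
forms. -/
def ballMetric (J : E →L[ℝ] E) (z : E) : E →L[ℝ] E →L[ℝ] ℝ :=
  (1 - ‖z‖ ^ 2)⁻¹ • realInnerCLM + ((1 - ‖z‖ ^ 2)⁻¹ ^ 2) •
    ((realInnerCLM z).smulRight (realInnerCLM z) +
      (realInnerCLM (J z)).smulRight (realInnerCLM (J z)))

/-- The Christoffel symbols of the complex hyperbolic metric of the unit ball. -/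
def ballChristoffel (J : E →L[ℝ] E) (z : E) : E →L[ℝ] E →L[ℝ] E :=
  (1 - ‖z‖ ^ 2)⁻¹ •
    (((realInnerCLM z).smulRight (ContinuousLinearMap.id ℝ E) + (realInnerCLM (J z)).smulRight J)
      + (ContinuousLinearMap.smulRightL ℝ E E (realInnerCLM z)
        + (ContinuousLinearMap.smulRightL ℝ E E (realInnerCLM (J z))).comp J))

lemma ballMetric_apply (J : E →L[ℝ] E) (z u w : E) :
    ballMetric J z u w = (1 - ‖z‖ ^ 2)⁻¹ * ⟪u, w⟫
      + (1 - ‖z‖ ^ 2)⁻¹ ^ 2 * (⟪z, u⟫ * ⟪z, w⟫ + ⟪J z, u⟫ * ⟪J z, w⟫) := by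
  simp [ballMetric, mul_add]

lemma ballChristoffel_apply (J : E →L[ℝ] E) (z u w : E) :
    ballChristoffel J z u w = (1 - ‖z‖ ^ 2)⁻¹ •
      (⟪z, u⟫ • w + ⟪J z, u⟫ • J w + (⟪z, w⟫ • u + ⟪J z, w⟫ • J u)) := by
  simp [ballChristoffel]

variable {J : E →L[ℝ] E} {z : E}

lemma one_sub_norm_sq_pos {E : Type*} [NormedAddCommGroup E] {z : E} (hz : ‖z‖ < 1) :
    0 < 1 - ‖z‖ ^ 2 := by
  have := norm_nonneg z
  nlinarith

lemma contDiffAt_inv_one_sub_norm_sq {n : ℕ∞ω} (hz : ‖z‖ < 1) :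
    ContDiffAt ℝ n (fun z : E => (1 - ‖z‖ ^ 2)⁻¹) z :=
  (contDiffAt_const.sub (contDiff_norm_sq ℝ).contDiffAt).inv (one_sub_norm_sq_pos hz).ne'

lemma contDiffAt_ballMetric {n : ℕ∞ω} (J : E →L[ℝ] E) (hz : ‖z‖ < 1) :
    ContDiffAt ℝ n (ballMetric J) z := by
  have hs := contDiffAt_inv_one_sub_norm_sq (n := n) hz
  have h1 : ContDiffAt ℝ n (fun z : E => realInnerCLM z) z := (realInnerCLM).contDiff.contDiffAt
  have h2 : ContDiffAt ℝ n (fun z : E => realInnerCLM (J z)) z :=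
    ((realInnerCLM).contDiff.comp J.contDiff).contDiffAt
  exact (hs.smul_bilinear contDiffAt_const).add
    ((hs.pow 2).smul_bilinear ((h1.smulRight h1).add (h2.smulRight h2)))

lemma contDiffAt_ballChristoffel {n : ℕ∞ω} (J : E →L[ℝ] E) (hz : ‖z‖ < 1) :
    ContDiffAt ℝ n (ballChristoffel J) z := by
  have hs := contDiffAt_inv_one_sub_norm_sq (n := n) hz
  have h1 : ContDiffAt ℝ n (fun z : E => realInnerCLM z) z := (realInnerCLM).contDiff.contDiffAt
  have h2 : ContDiffAt ℝ n (fun z : E => realInnerCLM (J z)) z :=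
    ((realInnerCLM).contDiff.comp J.contDiff).contDiffAt
  have h3 := (h1.smulRight (contDiffAt_const (c := ContinuousLinearMap.id ℝ E))).add
    (h2.smulRight (contDiffAt_const (c := J)))
  have h4 := ((ContinuousLinearMap.smulRightL ℝ E E).contDiff.contDiffAt.comp z h1).add
    (((ContinuousLinearMap.smulRightL ℝ E E).contDiff.contDiffAt.comp z h2).clm_comp
      (contDiffAt_const (c := J)))
  exact hs.smul_bilinear (h3.add h4)

lemma hasFDerivAt_inv_one_sub_norm_sq (hz : ‖z‖ < 1) :
    HasFDerivAt (fun z : E => (1 - ‖z‖ ^ 2)⁻¹)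
      ((2 * (1 - ‖z‖ ^ 2)⁻¹ ^ 2) • realInnerCLM z) z := by
  have h1 : HasFDerivAt (fun z : E => 1 - ‖z‖ ^ 2) (-(2 • realInnerCLM z)) z := by
    exact (hasStrictFDerivAt_norm_sq z).hasFDerivAt.const_sub 1
  have h2 := (hasDerivAt_inv (one_sub_norm_sq_pos hz).ne').comp_hasFDerivAt z h1
  refine h2.congr_fderiv ?_
  ext u
  simp
  ring

lemma fderiv_ballMetric (hz : ‖z‖ < 1) (d u w : E) :
    fderiv ℝ (ballMetric J) z d u w
      = 2 * (1 - ‖z‖ ^ 2)⁻¹ ^ 2 * ⟪z, d⟫ * ⟪u, w⟫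
        + 4 * (1 - ‖z‖ ^ 2)⁻¹ ^ 3 * ⟪z, d⟫ * (⟪z, u⟫ * ⟪z, w⟫ + ⟪J z, u⟫ * ⟪J z, w⟫)
        + (1 - ‖z‖ ^ 2)⁻¹ ^ 2 * (⟪d, u⟫ * ⟪z, w⟫ + ⟪z, u⟫ * ⟪d, w⟫ + ⟪J d, u⟫ * ⟪J z, w⟫
          + ⟪J z, u⟫ * ⟪J d, w⟫) := by
  rw [← fderiv_clm_apply_const
    ((contDiffAt_ballMetric (n := 1) J hz).differentiableAt (by simp)) u w d]
  have hs := hasFDerivAt_inv_one_sub_norm_sq hz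
  have hi (u : E) : HasFDerivAt (fun z : E => ⟪z, u⟫) (realInnerCLM.flip u) z :=
    (realInnerCLM.flip u).hasFDerivAt
  have hJ (u : E) : HasFDerivAt (fun z : E => ⟪J z, u⟫) ((realInnerCLM.flip u).comp J) z :=
    ((realInnerCLM.flip u).comp J).hasFDerivAt
  have h := (hs.mul_const ⟪u, w⟫).add
    ((hs.pow 2).mul (((hi u).mul (hi w)).add ((hJ u).mul (hJ w))))
  simp only [ballMetric_apply]
  erw [h.fderiv]
  generalize (1 - ‖z‖ ^ 2)⁻¹ = s
  simp
  ring

lemma fderiv_ballChristoffel (hz : ‖z‖ < 1) (d u w : E) :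
    fderiv ℝ (ballChristoffel J) z d u w
      = (2 * (1 - ‖z‖ ^ 2)⁻¹ ^ 2 * ⟪z, d⟫) •
          (⟪z, u⟫ • w + ⟪J z, u⟫ • J w + (⟪z, w⟫ • u + ⟪J z, w⟫ • J u))
        + (1 - ‖z‖ ^ 2)⁻¹ •
          (⟪d, u⟫ • w + ⟪J d, u⟫ • J w + (⟪d, w⟫ • u + ⟪J d, w⟫ • J u)) := by
  rw [← fderiv_clm_apply_const
    ((contDiffAt_ballChristoffel (n := 1) J hz).differentiableAt (by simp)) u w d]
  have hs := hasFDerivAt_inv_one_sub_norm_sq hz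
  have hi (u : E) : HasFDerivAt (fun z : E => ⟪z, u⟫) (realInnerCLM.flip u) z :=
    (realInnerCLM.flip u).hasFDerivAt
  have hJ (u : E) : HasFDerivAt (fun z : E => ⟪J z, u⟫) ((realInnerCLM.flip u).comp J) z :=
    ((realInnerCLM.flip u).comp J).hasFDerivAt
  have h := hs.smul ((((hi u).smul_const w).add ((hJ u).smul_const (J w))).add
    (((hi w).smul_const u).add ((hJ w).smul_const (J u))))
  simp only [ballChristoffel_apply]
  erw [h.fderiv]
  generalize (1 - ‖z‖ ^ 2)⁻¹ = s
  simp
  module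

lemma ballMetric_self_pos (J : E →L[ℝ] E) (hz : ‖z‖ < 1) {u : E} (hu : u ≠ 0) :
    0 < ballMetric J z u u := by
  have hs := one_sub_norm_sq_pos hz
  have hu' : 0 < ⟪u, u⟫ := real_inner_self_pos.2 hu
  have hs' := inv_pos.2 hs
  rw [ballMetric_apply]
  nlinarith [mul_pos hs' hu', mul_nonneg (sq_nonneg (1 - ‖z‖ ^ 2)⁻¹)
    (add_nonneg (mul_self_nonneg ⟪z, u⟫) (mul_self_nonneg ⟪J z, u⟫))]

/-- Positive definiteness gives uniqueness, so it suffices to test the closed form against the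
defining property. With `s = (1 - ‖z‖²)⁻¹`, both sides are polynomials in `s` and real inner
products that agree once `J` is moved across by skewness. -/
lemma christoffel_ballMetric (hJ : IsHermitianStructure J) (hz : ‖z‖ < 1) (u w : E) :
    christoffel (formOf (ballMetric J)) z u w = ballChristoffel J z u w := by
  refine christoffel_eq_of_forall (fun y hy => ?_) fun y => ?_
  · by_contra h
    exact (ballMetric_self_pos J hz h).ne' (hy y)
  · rw [christoffelFirst_formOf
      ((contDiffAt_ballMetric (n := 1) J hz).differentiableAt (by simp))]
    have h0 : (1 - ‖z‖ ^ 2)⁻¹ * (1 - ⟪z, z⟫) = 1 := by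
      rw [real_inner_self_eq_norm_sq]
      exact inv_mul_cancel₀ (one_sub_norm_sq_pos hz).ne'
    have hzz : ⟪J z, z⟫ = 0 := by
      have := hJ.inner_right z z
      rw [real_inner_comm] at this
      linarith
    simp only [fderiv_ballMetric hz, ballMetric_apply, ballChristoffel_apply]
    generalize (1 - ‖z‖ ^ 2)⁻¹ = s at *
    simp only [inner_smul_left, inner_smul_right, inner_add_left, inner_add_right, conj_trivial,
      hJ.inner_right, hJ.apply_apply, inner_neg_left]
    rw [real_inner_comm u w, real_inner_comm u y, real_inner_comm w y]
    rw [← real_inner_comm (J w) y, ← real_inner_comm (J u) y, ← real_inner_comm (J w) u]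
    simp only [hJ.inner_right]
    ring

/-- The curvature tensor of the complex hyperbolic metric. -/
theorem curvature_ballMetric (hJ : IsHermitianStructure J) (hz : ‖z‖ < 1) {A B C : E → E}
    (hA : DifferentiableAt ℝ A z) (hB : DifferentiableAt ℝ B z) (hC : ContDiffAt ℝ 2 C z) :
    curvature (formOf (ballMetric J)) A B C z
      = -(ballMetric J z (A z) (C z) • B z - ballMetric J z (B z) (C z) • A z
        + ballMetric J z (J (A z)) (C z) • J (B z) - ballMetric J z (J (B z)) (C z) • J (A z)
        + (2 * ballMetric J z (J (A z)) (B z)) • J (C z)) := by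
  have hev : ∀ᶠ y in 𝓝 z, ‖y‖ < 1 := continuous_norm.continuousAt.eventually_lt_const hz
  rw [curvature_eq_of_christoffel (Γ := ballChristoffel J)
    (by filter_upwards [hev] with y hy using christoffel_ballMetric hJ hy)
    ((contDiffAt_ballChristoffel (n := 1) J hz).differentiableAt (by simp)) hA hB hC]
  generalize A z = a
  generalize B z = b
  generalize C z = c
  simp only [fderiv_ballChristoffel hz, ballMetric_apply, ballChristoffel_apply]
  -- The factor can be treated as a free variable: the Christoffel vectors are combinations of `u`,
  -- `w`, `J u`, `J w` without a `z` component, so the compositions never produce `‖z‖²`.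
  generalize (1 - ‖z‖ ^ 2)⁻¹ = s at *
  have e1 : ⟪b, a⟫ = ⟪a, b⟫ := real_inner_comm _ _
  have f1 : ⟪J b, a⟫ = -⟪J a, b⟫ := by rw [real_inner_comm, hJ.inner_right]
  simp only [inner_smul_right, inner_add_right, hJ.inner_right, hJ.apply_apply, inner_neg_left,
    map_add, map_smul, e1, f1]
  match_scalars <;> ring

end ComplexHyperbolic

/-! ### The metric `μ` as a field of bilinear forms, and its regularity. -/

/-- Multiplication by `i` on `ℂᵐ`. -/
def mulI (m : ℕ) : CSpace m →L[ℝ] CSpace m :=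
  LinearMap.toContinuousLinearMap
    { toFun := fun u => Complex.I • u
      map_add' := fun u w => smul_add _ u w
      map_smul' := fun t u => smul_comm _ t u }

variable {m : ℕ}

@[simp] lemma mulI_apply (u : CSpace m) : mulI m u = Complex.I • u := rfl

lemma inner_real_eq_re (u w : CSpace m) : inner ℝ u w = (inner ℂ u w).re := by
  simp [PiLp.inner_apply, Complex.inner]

lemma isHermitianStructure_mulI : IsHermitianStructure (mulI m) where
  apply_apply u := by simp [smul_smul]
  inner_right u w := by
    simp only [mulI_apply, inner_real_eq_re, inner_smul_left, inner_smul_right]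
    simp

/-- Pairing with `J z` in the real inner product is the imaginary part of the Hermitian pairing with
`z`, so the real part of `⟨u, z⟩⟨z, w⟩` splits into the two real products. -/
lemma complexHyperbolicMetric_eq (z u w : CSpace m) :
    complexHyperbolicMetric z u w = ballMetric (mulI m) z u w := by
  have h1 : (inner ℂ u z).re = (inner ℂ z u).re := inner_re_symm (𝕜 := ℂ) u z
  have h2 : (inner ℂ u z).im = -(inner ℂ z u).im := inner_im_symm (𝕜 := ℂ) u z
  simp only [ballMetric_apply, complexHyperbolicMetric, mulI_apply, inner_real_eq_re,
    inner_smul_left, Complex.mul_re, h1, h2]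
  simp
  ring

/-- The angular one-form as a continuous linear map. -/
def angularCLM (β : CSpace m → CSpace m →L[ℝ] ℝ) (q : TotalSpace m) : TotalSpace m →L[ℝ] ℝ :=
  (ContinuousLinearMap.fst ℝ ℝ ℝ).comp (ContinuousLinearMap.snd ℝ (CSpace m) (ℝ × ℝ))
    + (β q.1).comp (ContinuousLinearMap.fst ℝ (CSpace m) (ℝ × ℝ))

lemma angularCLM_apply (β : CSpace m → CSpace m →L[ℝ] ℝ) (q u : TotalSpace m) :
    angularCLM β q u = u.2.1 + β q.1 u.1 := rfl

/-- The one-form `dr`. -/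
def radialCLM (m : ℕ) : TotalSpace m →L[ℝ] ℝ :=
  (ContinuousLinearMap.snd ℝ ℝ ℝ).comp (ContinuousLinearMap.snd ℝ (CSpace m) (ℝ × ℝ))

lemma radialCLM_apply (u : TotalSpace m) : radialCLM m u = u.2.2 := rfl

/-- The metric `μ` as a field of bilinear forms. -/
def muForm (h v : ℝ → ℝ) (β : CSpace m → CSpace m →L[ℝ] ℝ) (q : TotalSpace m) :
    TotalSpace m →L[ℝ] TotalSpace m →L[ℝ] ℝ :=
  (h q.2.2 ^ 2) • (ContinuousLinearMap.precomp ℝ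
      (ContinuousLinearMap.fst ℝ (CSpace m) (ℝ × ℝ))).comp
        ((ballMetric (mulI m) q.1).comp (ContinuousLinearMap.fst ℝ (CSpace m) (ℝ × ℝ)))
    + ((1 / 4) * v q.2.2 ^ 2) • (angularCLM β q).smulRight (angularCLM β q)
    + (radialCLM m).smulRight (radialCLM m)

lemma muForm_apply (h v : ℝ → ℝ) (β : CSpace m → CSpace m →L[ℝ] ℝ) (q u w : TotalSpace m) :
    muForm h v β q u w = h q.2.2 ^ 2 * ballMetric (mulI m) q.1 u.1 w.1
      + (1 / 4) * v q.2.2 ^ 2 * ((u.2.1 + β q.1 u.1) * (w.2.1 + β q.1 w.1))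
      + u.2.2 * w.2.2 := by
  simp [muForm, angularCLM_apply, radialCLM_apply]

lemma muMetric_eq_formOf (h v : ℝ → ℝ) (β : CSpace m → CSpace m →L[ℝ] ℝ) :
    muMetric h v β = formOf (muForm h v β) := by
  funext q u w
  simp only [formOf, muForm_apply, muMetric, angularForm, complexHyperbolicMetric_eq]

lemma curvComp_eq (h v : ℝ → ℝ) (β : CSpace m → CSpace m →L[ℝ] ℝ)
    (X : BaseIndex m → CSpace m → CSpace m) (q : TotalSpace m) (a b c d : FrameIndex m) :
    curvComp h v β X q a b c d
      = curvatureCoeff (muForm h v β) (adaptedFrame h v β X) q a b c d := by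
  simp only [curvComp, curvatureCoeff, muMetric_eq_formOf]

/-- Regularity of the data at a point of the total space, and orthonormality of the base frame
near its projection. -/
structure IsRegularAt (h v : ℝ → ℝ) (β : CSpace m → CSpace m →L[ℝ] ℝ)
    (X : BaseIndex m → CSpace m → CSpace m) (q : TotalSpace m) : Prop where
  norm_lt : ‖q.1‖ < 1
  h_pos : 0 < h q.2.2
  v_pos : 0 < v q.2.2
  contDiffAt_h : ContDiffAt ℝ 2 h q.2.2
  contDiffAt_v : ContDiffAt ℝ 2 v q.2.2
  contDiffAt_form : ContDiffAt ℝ 2 β q.1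
  frame : IsOrthonormalFrameAt (ballMetric (mulI m)) X q.1

lemma ballMetric_symm {E : Type*} [NormedAddCommGroup E] [InnerProductSpace ℝ E]
    (J : E →L[ℝ] E) (z u w : E) : ballMetric J z u w = ballMetric J z w u := by
  rw [ballMetric_apply, ballMetric_apply, real_inner_comm]
  ring

lemma finrank_CSpace (m : ℕ) : Module.finrank ℝ (CSpace m) = 2 * m := by
  rw [finrank_real_of_complex, finrank_euclideanSpace, Fintype.card_fin]

lemma IsHolomorphicFrame.isOrthonormalFrameAt {X : BaseIndex m → CSpace m → CSpace m}
    {p : CSpace m} (hX : IsHolomorphicFrame X p) (hp : ‖p‖ < 1) :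
    IsOrthonormalFrameAt (ballMetric (mulI m)) X p where
  symm := ballMetric_symm _
  contDiffAt_metric := contDiffAt_ballMetric _ hp
  contDiffAt i := (hX.smooth i).of_le (WithTop.coe_le_coe.2 le_top)
  orthonormal := by simpa only [complexHyperbolicMetric_eq] using hX.orthonormal
  card_eq := by simp [finrank_CSpace, mul_comm]

lemma horizontalLift_apply (β : CSpace m → CSpace m →L[ℝ] ℝ) (A : CSpace m → CSpace m)
    (q : TotalSpace m) : horizontalLift β A q = (A q.1, -(β q.1 (A q.1)), 0) := rfl

/-! ### Horizontal lifts and their brackets. -/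

section Lifts

variable {β : CSpace m → CSpace m →L[ℝ] ℝ} {A B : CSpace m → CSpace m} {q : TotalSpace m}

lemma contDiffAt_horizontalLift {n : ℕ∞ω} (hβ : ContDiffAt ℝ n β q.1)
    (hA : ContDiffAt ℝ n A q.1) : ContDiffAt ℝ n (horizontalLift β A) q := by
  have h1 : ContDiffAt ℝ n (fun q : TotalSpace m => β q.1) q := hβ.comp q contDiffAt_fst
  have h2 : ContDiffAt ℝ n (fun q : TotalSpace m => A q.1) q := hA.comp q contDiffAt_fst
  exact h2.prodMk ((h1.clm_apply h2).neg.prodMk contDiffAt_const)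

lemma fderiv_horizontalLift (hβ : DifferentiableAt ℝ β q.1) (hA : DifferentiableAt ℝ A q.1)
    (u : TotalSpace m) : fderiv ℝ (horizontalLift β A) q u
      = (fderiv ℝ A q.1 u.1,
        -(fderiv ℝ β q.1 u.1 (A q.1) + β q.1 (fderiv ℝ A q.1 u.1)), 0) := by
  have h1 : HasFDerivAt (fun q : TotalSpace m => β q.1)
      ((fderiv ℝ β q.1).comp (ContinuousLinearMap.fst ℝ _ _)) q :=
    hβ.hasFDerivAt.comp q hasFDerivAt_fst
  have h2 : HasFDerivAt (fun q : TotalSpace m => A q.1)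
      ((fderiv ℝ A q.1).comp (ContinuousLinearMap.fst ℝ _ _)) q :=
    hA.hasFDerivAt.comp q hasFDerivAt_fst
  have h3 := h2.prodMk ((h1.clm_apply h2).neg.prodMk (hasFDerivAt_const (0 : ℝ) q))
  have h4 : HasFDerivAt (horizontalLift β A) _ q := h3
  rw [h4.fderiv]
  simp
  ring

/-- The terms that differentiate `A` and `B` form the lift of `[A, B]`; what remains is `-dβ(A, B)
∂/∂θ`, the curvature of the horizontal distribution. -/
lemma lieBracket_horizontalLift (hβ : DifferentiableAt ℝ β q.1)
    (hA : DifferentiableAt ℝ A q.1) (hB : DifferentiableAt ℝ B q.1) :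
    lieBracket ℝ (horizontalLift β A) (horizontalLift β B) q
      = (lieBracket ℝ A B q.1, fderiv ℝ β q.1 (B q.1) (A q.1) - fderiv ℝ β q.1 (A q.1) (B q.1)
          - β q.1 (lieBracket ℝ A B q.1), 0) := by
  simp only [lieBracket, fderiv_horizontalLift hβ hA, fderiv_horizontalLift hβ hB,
    horizontalLift_apply, Prod.mk_sub_mk, map_sub, sub_zero]
  congr 2
  ring

end Lifts

/-- The `∂/∂θ`-coefficients of the brackets of the horizontal lifts of a frame. -/
def angularCoeff (β : CSpace m → CSpace m →L[ℝ] ℝ) (X : BaseIndex m → CSpace m → CSpace m)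
    (i j : BaseIndex m) (z : CSpace m) : ℝ :=
  fderiv ℝ β z (X j z) (X i z) - fderiv ℝ β z (X i z) (X j z)

/-! ### The adapted frame: orthonormality and Lie brackets. -/

namespace IsRegularAt

variable {h v : ℝ → ℝ} {β : CSpace m → CSpace m →L[ℝ] ℝ}
  {X : BaseIndex m → CSpace m → CSpace m} {q : TotalSpace m}

lemma eventually (hq : IsRegularAt h v β X q) : ∀ᶠ q' in 𝓝 q, IsRegularAt h v β X q' := by
  have t1 : Filter.Tendsto (fun q : TotalSpace m => q.1) (𝓝 q) (𝓝 q.1) := continuousAt_fst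
  have t2 : Filter.Tendsto (fun q : TotalSpace m => q.2.2) (𝓝 q) (𝓝 q.2.2) :=
    (continuous_snd.comp continuous_snd).continuousAt
  filter_upwards [t1.eventually (continuous_norm.continuousAt.eventually_lt_const hq.norm_lt),
    t2.eventually (hq.contDiffAt_h.continuousAt.eventually_const_lt hq.h_pos),
    t2.eventually (hq.contDiffAt_v.continuousAt.eventually_const_lt hq.v_pos),
    t2.eventually (hq.contDiffAt_h.eventually (by simp)),
    t2.eventually (hq.contDiffAt_v.eventually (by simp)),
    t1.eventually (hq.contDiffAt_form.eventually (by simp)),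
    t1.eventually hq.frame.eventually] with q' a1 a2 a3 a4 a5 a6 a7
  exact ⟨a1, a2, a3, a4, a5, a6, a7⟩

lemma contDiffAt_muForm (hq : IsRegularAt h v β X q) : ContDiffAt ℝ 2 (muForm h v β) q := by
  have c1 : ContDiffAt ℝ 2 (fun q : TotalSpace m => q.2.2) q := contDiffAt_snd.snd
  have ch : ContDiffAt ℝ 2 (fun q : TotalSpace m => h q.2.2) q :=
    hq.contDiffAt_h.comp (f := fun q : TotalSpace m => q.2.2) q c1
  have cv : ContDiffAt ℝ 2 (fun q : TotalSpace m => v q.2.2) q :=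
    hq.contDiffAt_v.comp (f := fun q : TotalSpace m => q.2.2) q c1
  have cβ : ContDiffAt ℝ 2 (fun q : TotalSpace m => β q.1) q :=
    hq.contDiffAt_form.comp q contDiffAt_fst
  have cb : ContDiffAt ℝ 2 (fun q : TotalSpace m => ballMetric (mulI m) q.1) q :=
    (contDiffAt_ballMetric _ hq.norm_lt).comp q contDiffAt_fst
  have cη : ContDiffAt ℝ 2 (angularCLM β) q :=
    contDiffAt_const.add (cβ.clm_comp contDiffAt_const)
  exact (((ch.pow 2).smul_bilinear (contDiffAt_const.clm_comp
    (cb.clm_comp contDiffAt_const))).add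
      ((contDiffAt_const.mul (cv.pow 2)).smul_bilinear (cη.smulRight cη))).add contDiffAt_const

lemma contDiffAt_adaptedFrame (hq : IsRegularAt h v β X q) (a : FrameIndex m) :
    ContDiffAt ℝ 2 (adaptedFrame h v β X a) q := by
  have c1 : ContDiffAt ℝ 2 (fun q : TotalSpace m => q.2.2) q := contDiffAt_snd.snd
  have ch : ContDiffAt ℝ 2 (fun q : TotalSpace m => h q.2.2) q :=
    hq.contDiffAt_h.comp (f := fun q : TotalSpace m => q.2.2) q c1
  have cv : ContDiffAt ℝ 2 (fun q : TotalSpace m => v q.2.2) q :=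
    hq.contDiffAt_v.comp (f := fun q : TotalSpace m => q.2.2) q c1
  rcases a with i | _ | _
  · exact (ch.inv hq.h_pos.ne').smul
      (contDiffAt_horizontalLift hq.contDiffAt_form (hq.frame.contDiffAt i))
  · exact ((contDiffAt_const.mul cv).inv (mul_pos (by norm_num) hq.v_pos).ne').smul
      contDiffAt_const
  · exact contDiffAt_const

lemma muForm_adaptedFrame (hq : IsRegularAt h v β X q) (a b : FrameIndex m) :
    muForm h v β q (adaptedFrame h v β X a q) (adaptedFrame h v β X b q)
      = if a = b then 1 else 0 := by
  have h1 := hq.h_pos.ne'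
  have h2 := hq.v_pos.ne'
  have h3 := hq.frame.apply_eq
  rcases a with i | _ | _ <;> rcases b with j | _ | _ <;>
    simp [muForm_apply, adaptedFrame, horizontalLift, dTheta, dR, h3]
  · split_ifs <;> field_simp
  · field_simp
    norm_num

lemma isOrthonormalFrameAt (hq : IsRegularAt h v β X q) :
    IsOrthonormalFrameAt (muForm h v β) (adaptedFrame h v β X) q where
  symm q u w := by
    rw [muForm_apply, muForm_apply, ballMetric_symm]
    ring
  contDiffAt_metric := hq.contDiffAt_muForm
  contDiffAt := hq.contDiffAt_adaptedFrame
  orthonormal := by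
    filter_upwards [hq.eventually] with q' hq' using hq'.muForm_adaptedFrame
  card_eq := by
    simp [Module.finrank_prod, finrank_CSpace]
    ring

lemma hasDerivAt_h (hq : IsRegularAt h v β X q) : HasDerivAt h (deriv h q.2.2) q.2.2 :=
  (hq.contDiffAt_h.differentiableAt (by simp)).hasDerivAt

lemma hasDerivAt_v (hq : IsRegularAt h v β X q) : HasDerivAt v (deriv v q.2.2) q.2.2 :=
  (hq.contDiffAt_v.differentiableAt (by simp)).hasDerivAt

lemma differentiableAt_form (hq : IsRegularAt h v β X q) : DifferentiableAt ℝ β q.1 :=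
  hq.contDiffAt_form.differentiableAt (by simp)

lemma fderiv_adaptedFrame_hor (hq : IsRegularAt h v β X q) (i : BaseIndex m)
    (u : TotalSpace m) : fderiv ℝ (adaptedFrame h v β X (hor i)) q u
      = (h q.2.2)⁻¹ • fderiv ℝ (horizontalLift β (X i)) q u
        - (deriv h q.2.2 / h q.2.2 ^ 2 * u.2.2) • horizontalLift β (X i) q := by
  have h1 : HasFDerivAt (fun q : TotalSpace m => (h q.2.2)⁻¹)
      ((-deriv h q.2.2 / h q.2.2 ^ 2) • radialCLM m) q :=
    (hq.hasDerivAt_h.inv hq.h_pos.ne').comp_hasFDerivAt (f := fun q : TotalSpace m => q.2.2) q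
      (radialCLM m).hasFDerivAt
  have h2 : DifferentiableAt ℝ (horizontalLift β (X i)) q :=
    (contDiffAt_horizontalLift hq.contDiffAt_form (hq.frame.contDiffAt i)).differentiableAt
      (by simp)
  have h3 : HasFDerivAt (adaptedFrame h v β X (hor i)) _ q := h1.smul h2.hasFDerivAt
  rw [h3.fderiv]
  simp only [add_apply, smul_apply, ContinuousLinearMap.smulRight_apply, radialCLM_apply,
    smul_eq_mul]
  module

lemma fderiv_adaptedFrame_ang (hq : IsRegularAt h v β X q) (u : TotalSpace m) :
    fderiv ℝ (adaptedFrame h v β X ang) q u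
      = -((2 * deriv v q.2.2 / v q.2.2 ^ 2 * u.2.2) • dTheta m) := by
  have h0 : HasDerivAt (fun r => (1 / 2) * v r) ((1 / 2) * deriv v q.2.2) q.2.2 :=
    hq.hasDerivAt_v.const_mul _
  have h1 : HasFDerivAt (fun q : TotalSpace m => ((1 / 2) * v q.2.2)⁻¹)
      ((-((1 / 2) * deriv v q.2.2) / ((1 / 2) * v q.2.2) ^ 2) • radialCLM m) q :=
    (h0.inv (mul_pos (by norm_num) hq.v_pos).ne').comp_hasFDerivAt
      (f := fun q : TotalSpace m => q.2.2) q (radialCLM m).hasFDerivAt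
  have h3 : HasFDerivAt (adaptedFrame h v β X ang) _ q := h1.smul_const (dTheta m)
  rw [h3.fderiv]
  simp only [smul_apply, ContinuousLinearMap.smulRight_apply, radialCLM_apply, smul_eq_mul]
  rw [← neg_smul]
  congr 1
  have := hq.v_pos.ne'
  field_simp

/-- The factor `1/h` depends only on `r`, and horizontal vectors have no radial component, so the
scalar is not differentiated. -/
lemma lieBracket_hor_hor (hq : IsRegularAt h v β X q) (i j : BaseIndex m) :
    lieBracket ℝ (adaptedFrame h v β X (hor i)) (adaptedFrame h v β X (hor j)) q
      = ((h q.2.2)⁻¹ ^ 2) •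
        lieBracket ℝ (horizontalLift β (X i)) (horizontalLift β (X j)) q := by
  have e (i) : adaptedFrame h v β X (hor i) q = (h q.2.2)⁻¹ • horizontalLift β (X i) q := rfl
  have e0 (i) : ((h q.2.2)⁻¹ • horizontalLift β (X i) q).2.2 = 0 := by simp [horizontalLift]
  simp only [lieBracket, hq.fderiv_adaptedFrame_hor, e, e0, map_smul]
  module

lemma lieBracket_rad_hor (hq : IsRegularAt h v β X q) (i : BaseIndex m) :
    lieBracket ℝ (adaptedFrame h v β X rad) (adaptedFrame h v β X (hor i)) q
      = -((deriv h q.2.2 / h q.2.2) • adaptedFrame h v β X (hor i) q) := by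
  have h0 : fderiv ℝ (adaptedFrame h v β X rad) q = 0 := by simp [adaptedFrame]
  have hh := hq.h_pos.ne'
  simp only [lieBracket, hq.fderiv_adaptedFrame_hor, h0,
    fderiv_horizontalLift hq.differentiableAt_form (hq.frame.differentiableAt i)]
  simp only [adaptedFrame, dR, map_zero, zero_apply, smul_smul, add_zero, neg_zero,
    Prod.mk_zero_zero, smul_zero, sub_zero, zero_sub, mul_one]
  congr 2
  field_simp

lemma lieBracket_rad_ang (hq : IsRegularAt h v β X q) :
    lieBracket ℝ (adaptedFrame h v β X rad) (adaptedFrame h v β X ang) q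
      = -((deriv v q.2.2 / v q.2.2) • adaptedFrame h v β X ang q) := by
  have h0 : fderiv ℝ (adaptedFrame h v β X rad) q = 0 := by simp [adaptedFrame]
  have hh := hq.v_pos.ne'
  simp only [lieBracket, hq.fderiv_adaptedFrame_ang, h0]
  simp only [adaptedFrame, dR, zero_apply, smul_smul, sub_zero]
  congr 2
  field_simp

lemma lieBracket_ang_hor (hq : IsRegularAt h v β X q) (i : BaseIndex m) :
    lieBracket ℝ (adaptedFrame h v β X ang) (adaptedFrame h v β X (hor i)) q = 0 := by
  simp only [lieBracket, hq.fderiv_adaptedFrame_hor, hq.fderiv_adaptedFrame_ang,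
    fderiv_horizontalLift hq.differentiableAt_form (hq.frame.differentiableAt i)]
  simp [adaptedFrame, dTheta, horizontalLift]

end IsRegularAt

/-! ### Bracket and connection coefficients of the adapted frame. -/

/-- The shape of the bracket coefficients of an adapted frame: `b` are the horizontal ones, `α` is
half of the angular ones, `H` and `W` are the logarithmic derivatives of the warping functions. -/
def bracketModel (H W : ℝ) (b : BaseIndex m → BaseIndex m → BaseIndex m → ℝ)
    (α : BaseIndex m → BaseIndex m → ℝ) : FrameIndex m → FrameIndex m → FrameIndex m → ℝ
  | Sum.inl i, Sum.inl j, Sum.inl k => b i j k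
  | Sum.inl i, Sum.inl j, Sum.inr false => 2 * α i j
  | Sum.inl i, Sum.inr true, Sum.inl j => if i = j then H else 0
  | Sum.inr true, Sum.inl i, Sum.inl j => if i = j then -H else 0
  | Sum.inr false, Sum.inr true, Sum.inr false => W
  | Sum.inr true, Sum.inr false, Sum.inr false => -W
  | _, _, _ => 0

/-- The shape of the connection coefficients of an adapted frame. -/
def connectionModel (H W : ℝ) (κ : BaseIndex m → BaseIndex m → BaseIndex m → ℝ)
    (α : BaseIndex m → BaseIndex m → ℝ) : FrameIndex m → FrameIndex m → FrameIndex m → ℝ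
  | Sum.inl i, Sum.inl j, Sum.inl k => κ i j k
  | Sum.inl i, Sum.inl j, Sum.inr false => α i j
  | Sum.inl i, Sum.inr false, Sum.inl j => -α i j
  | Sum.inr false, Sum.inl i, Sum.inl j => -α i j
  | Sum.inl i, Sum.inl j, Sum.inr true => if i = j then -H else 0
  | Sum.inl i, Sum.inr true, Sum.inl j => if i = j then H else 0
  | Sum.inr false, Sum.inr false, Sum.inr true => -W
  | Sum.inr false, Sum.inr true, Sum.inr false => W
  | _, _, _ => 0

lemma angularCoeff_swap (β : CSpace m → CSpace m →L[ℝ] ℝ) (X : BaseIndex m → CSpace m → CSpace m)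
    (i j : BaseIndex m) (z : CSpace m) : angularCoeff β X j i z = -angularCoeff β X i j z := by
  simp [angularCoeff]

lemma differentiableAt_deriv {f : ℝ → ℝ} {r : ℝ} (hf : ContDiffAt ℝ 2 f r) :
    DifferentiableAt ℝ (deriv f) r := by
  have h1 : DifferentiableAt ℝ (fderiv ℝ f) r :=
    (hf.fderiv_right (m := 1) (by norm_num)).differentiableAt (by simp)
  exact h1.clm_apply (differentiableAt_const (1 : ℝ))

namespace IsRegularAt

variable {h v : ℝ → ℝ} {β : CSpace m → CSpace m →L[ℝ] ℝ}
  {X : BaseIndex m → CSpace m → CSpace m} {q : TotalSpace m}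

/-- The constant in `α`: two factors `1/h` come from the fields and `v/2` from writing `∂/∂θ` in the
unit angular vector, so the angular coefficient is `v/(2h²)` times `angularCoeff`, and half of it is
kept. -/
lemma bracketCoeff_eq (hq : IsRegularAt h v β X q) (a b c : FrameIndex m) :
    bracketCoeff (muForm h v β) (adaptedFrame h v β X) a b c q
      = bracketModel (deriv h q.2.2 / h q.2.2) (deriv v q.2.2 / v q.2.2)
        (fun i j k => (h q.2.2)⁻¹ * bracketCoeff (ballMetric (mulI m)) X i j k q.1)
        (fun i j => v q.2.2 / (4 * h q.2.2 ^ 2) * angularCoeff β X i j q.1) a b c := by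
  have hh := hq.h_pos.ne'
  have hv := hq.v_pos.ne'
  have hF := hq.muForm_adaptedFrame
  have e1 : ∀ (i j : BaseIndex m) (c : FrameIndex m), bracketCoeff (muForm h v β)
      (adaptedFrame h v β X) (hor i) (hor j) c q = bracketModel (deriv h q.2.2 / h q.2.2)
        (deriv v q.2.2 / v q.2.2)
        (fun i j k => (h q.2.2)⁻¹ * bracketCoeff (ballMetric (mulI m)) X i j k q.1)
        (fun i j => v q.2.2 / (4 * h q.2.2 ^ 2) * angularCoeff β X i j q.1)
        (hor i) (hor j) c := by
    intro i j c
    rw [bracketCoeff, hq.lieBracket_hor_hor, lieBracket_horizontalLift hq.differentiableAt_form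
      (hq.frame.differentiableAt i) (hq.frame.differentiableAt j)]
    rcases c with k | _ | _
    · simp [muForm_apply, adaptedFrame, horizontalLift, bracketModel, bracketCoeff]
      field_simp
    · simp [muForm_apply, adaptedFrame, dTheta, bracketModel, angularCoeff]
      field_simp
      ring
    · simp [muForm_apply, adaptedFrame, dR, bracketModel]
  have e2 : ∀ (i : BaseIndex m) (c : FrameIndex m), bracketCoeff (muForm h v β)
      (adaptedFrame h v β X) rad (hor i) c q
        = -(deriv h q.2.2 / h q.2.2 * if hor i = c then 1 else 0) := by
    intro i c
    rw [bracketCoeff, hq.lieBracket_rad_hor]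
    simp [hF]
  have e3 : ∀ c : FrameIndex m, bracketCoeff (muForm h v β)
      (adaptedFrame h v β X) rad ang c q
        = -(deriv v q.2.2 / v q.2.2 * if ang = c then 1 else 0) := by
    intro c
    rw [bracketCoeff, hq.lieBracket_rad_ang]
    simp [hF]
  have e4 : ∀ (i : BaseIndex m) (c : FrameIndex m), bracketCoeff (muForm h v β)
      (adaptedFrame h v β X) ang (hor i) c q = 0 := by
    intro i c
    rw [bracketCoeff, hq.lieBracket_ang_hor]
    simp
  have e5 : ∀ a c : FrameIndex m, bracketCoeff (muForm h v β)
      (adaptedFrame h v β X) a a c q = 0 := by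
    intro a c
    simp [bracketCoeff]
  rcases a with i | _ | _ <;> rcases b with j | _ | _
  · exact e1 i j c
  · rw [bracketCoeff_swap, e4]
    rcases c with k | _ | _ <;> simp [bracketModel]
  · rw [bracketCoeff_swap, e2]
    rcases c with k | _ | _ <;> simp [bracketModel]
  · rw [e4]
    rcases c with k | _ | _ <;> simp [bracketModel]
  · rw [e5]
    rcases c with k | _ | _ <;> simp [bracketModel]
  · rw [bracketCoeff_swap, e3]
    rcases c with k | _ | _ <;> simp [bracketModel]
  · rw [e2]
    rcases c with k | _ | _ <;> simp [bracketModel]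
    split_ifs <;> simp
  · rw [e3]
    rcases c with k | _ | _ <;> simp [bracketModel]
  · rw [e5]
    rcases c with k | _ | _ <;> simp [bracketModel]

lemma connectionCoeff_eq (hq : IsRegularAt h v β X q) (a b c : FrameIndex m) :
    connectionCoeff (muForm h v β) (adaptedFrame h v β X) a b c q
      = connectionModel (deriv h q.2.2 / h q.2.2) (deriv v q.2.2 / v q.2.2)
        (fun i j k => (h q.2.2)⁻¹ * connectionCoeff (ballMetric (mulI m)) X i j k q.1)
        (fun i j => v q.2.2 / (4 * h q.2.2 ^ 2) * angularCoeff β X i j q.1) a b c := by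
  have hs := angularCoeff_swap β X
  simp only [connectionCoeff, hq.bracketCoeff_eq]
  rcases a with i | _ | _ <;> rcases b with j | _ | _ <;> rcases c with k | _ | _ <;>
    simp only [bracketModel, connectionModel] <;> try ring1
  · simp only [eq_comm (a := j) (b := i)]
    split_ifs <;> ring
  · rw [hs i k]
    ring
  · simp only [eq_comm (a := k) (b := i)]
    split_ifs <;> ring
  · simp only [eq_comm (a := k) (b := j)]
    split_ifs <;> ring

lemma differentiableAt_angularCoeff (hq : IsRegularAt h v β X q) (i j : BaseIndex m) :
    DifferentiableAt ℝ (angularCoeff β X i j) q.1 := by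
  have h1 : DifferentiableAt ℝ (fderiv ℝ β) q.1 :=
    (hq.contDiffAt_form.fderiv_right (m := 1) (by norm_num)).differentiableAt (by simp)
  have h2 := hq.frame.differentiableAt
  exact ((h1.clm_apply (h2 j)).clm_apply (h2 i)).sub ((h1.clm_apply (h2 i)).clm_apply (h2 j))

/-- Regularity is an open condition, so the formula for the coefficients can be differentiated. Each
entry is a function of `r` times a function of `z`, and the product rule preserves the shape of
`connectionModel`. -/
lemma fderiv_connectionCoeff (hq : IsRegularAt h v β X q) (a b c : FrameIndex m)
    (u : TotalSpace m) :
    fderiv ℝ (connectionCoeff (muForm h v β) (adaptedFrame h v β X) a b c) q u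
      = connectionModel (deriv (fun r => deriv h r / h r) q.2.2 * u.2.2)
        (deriv (fun r => deriv v r / v r) q.2.2 * u.2.2)
        (fun i j k => deriv (fun r => (h r)⁻¹) q.2.2 * u.2.2
            * connectionCoeff (ballMetric (mulI m)) X i j k q.1
          + (h q.2.2)⁻¹ * fderiv ℝ (connectionCoeff (ballMetric (mulI m)) X i j k) q.1 u.1)
        (fun i j => deriv (fun r => v r / (4 * h r ^ 2)) q.2.2 * u.2.2 * angularCoeff β X i j q.1
          + v q.2.2 / (4 * h q.2.2 ^ 2) * fderiv ℝ (angularCoeff β X i j) q.1 u.1) a b c := by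
  have hh := hq.h_pos.ne'
  have hv := hq.v_pos.ne'
  have dh : DifferentiableAt ℝ h q.2.2 := hq.contDiffAt_h.differentiableAt (by simp)
  have dv : DifferentiableAt ℝ v q.2.2 := hq.contDiffAt_v.differentiableAt (by simp)
  have d1 : DifferentiableAt ℝ (fun r => deriv h r / h r) q.2.2 :=
    (differentiableAt_deriv hq.contDiffAt_h).div dh hh
  have d2 : DifferentiableAt ℝ (fun r => deriv v r / v r) q.2.2 :=
    (differentiableAt_deriv hq.contDiffAt_v).div dv hv
  have d3 : DifferentiableAt ℝ (fun r => (h r)⁻¹) q.2.2 := dh.inv hh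
  have d4 : DifferentiableAt ℝ (fun r => v r / (4 * h r ^ 2)) q.2.2 :=
    dv.div ((dh.pow 2).const_mul 4) (by positivity)
  have rule1 {f : ℝ → ℝ} (hf : DifferentiableAt ℝ f q.2.2) :
      HasFDerivAt (fun q : TotalSpace m => f q.2.2) (deriv f q.2.2 • radialCLM m) q :=
    hf.hasDerivAt.comp_hasFDerivAt (f := fun q : TotalSpace m => q.2.2) q
      (radialCLM m).hasFDerivAt
  have rule2 {f : ℝ → ℝ} {F : CSpace m → ℝ} (hf : DifferentiableAt ℝ f q.2.2)
      (hF : DifferentiableAt ℝ F q.1) :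
      fderiv ℝ (fun q : TotalSpace m => f q.2.2 * F q.1) q u
        = deriv f q.2.2 * u.2.2 * F q.1 + f q.2.2 * fderiv ℝ F q.1 u.1 := by
    have h2 : HasFDerivAt (fun q : TotalSpace m => F q.1)
        ((fderiv ℝ F q.1).comp (ContinuousLinearMap.fst ℝ _ _)) q :=
      hF.hasFDerivAt.comp q hasFDerivAt_fst
    have h3 : HasFDerivAt (fun q : TotalSpace m => f q.2.2 * F q.1) _ q := (rule1 hf).mul h2
    rw [h3.fderiv]
    simp [radialCLM_apply]
    ring
  have rule3 {f : ℝ → ℝ} (hf : DifferentiableAt ℝ f q.2.2) :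
      fderiv ℝ (fun q : TotalSpace m => f q.2.2) q u = deriv f q.2.2 * u.2.2 := by
    rw [(rule1 hf).fderiv]
    simp [radialCLM_apply]
  have ev : connectionCoeff (muForm h v β) (adaptedFrame h v β X) a b c =ᶠ[𝓝 q] fun q =>
      connectionModel (deriv h q.2.2 / h q.2.2) (deriv v q.2.2 / v q.2.2)
        (fun i j k => (h q.2.2)⁻¹ * connectionCoeff (ballMetric (mulI m)) X i j k q.1)
        (fun i j => v q.2.2 / (4 * h q.2.2 ^ 2) * angularCoeff β X i j q.1) a b c := by
    filter_upwards [hq.eventually] with q' hq' using hq'.connectionCoeff_eq a b c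
  rw [ev.fderiv_eq]
  have r1 := rule3 d1
  have r2 := rule3 d2
  have r3 (i j k) := rule2 d3 (hq.frame.differentiableAt_connectionCoeff i j k)
  have r4 (i j) := rule2 d4 (hq.differentiableAt_angularCoeff i j)
  rcases a with i | _ | _ <;> rcases b with j | _ | _ <;> rcases c with k | _ | _ <;>
    simp only [connectionModel] <;>
    first
    | exact r3 _ _ _
    | exact r4 _ _
    | (simp only [fderiv_fun_neg, neg_apply, r4, r2])
    | exact r2
    | (split_ifs <;> simp [r1])
    | simp

end IsRegularAt

/-! ### Curvature of the adapted frame as finite algebra. -/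

/-- The derivatives of the connection coefficients of an adapted frame along the vectors of the
frame, at a point where the horizontal connection coefficients vanish. -/
def connectionDerivModel (H' W' : ℝ)
    (κ' : BaseIndex m → BaseIndex m → BaseIndex m → BaseIndex m → ℝ)
    (αr : BaseIndex m → BaseIndex m → ℝ) (α' : BaseIndex m → BaseIndex m → BaseIndex m → ℝ) :
    FrameIndex m → FrameIndex m → FrameIndex m → FrameIndex m → ℝ
  | Sum.inl i => connectionModel 0 0 (κ' i) (α' i)
  | Sum.inr false => fun _ _ _ => 0
  | Sum.inr true => connectionModel H' W' (fun _ _ _ => 0) αr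

/-- The curvature components, in terms of bracket coefficients `C`, connection coefficients `K` and
derivatives `D a b c d` of `K b c d` along the `a`-th vector of an orthonormal frame. -/
def curvatureModel {ι : Type*} [Fintype ι] (C K : ι → ι → ι → ℝ) (D : ι → ι → ι → ι → ℝ)
    (a b c d : ι) : ℝ :=
  (∑ f, C a b f * K f c d) - D a b c d - (∑ e, K b c e * K a e d) + D b a c d
    + ∑ e, K a c e * K b e d

section Model

variable (H W H' W' : ℝ) (κ' : BaseIndex m → BaseIndex m → BaseIndex m → BaseIndex m → ℝ)
  (α αr : BaseIndex m → BaseIndex m → ℝ) (α' : BaseIndex m → BaseIndex m → BaseIndex m → ℝ)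

/-- The curvature components of an adapted frame at a point where the horizontal connection
coefficients vanish. -/
def adaptedCurvature : FrameIndex m → FrameIndex m → FrameIndex m → FrameIndex m → ℝ :=
  curvatureModel (bracketModel H W (fun _ _ _ => 0) α) (connectionModel H W (fun _ _ _ => 0) α)
    (connectionDerivModel H' W' κ' αr α')

variable (i j k l : BaseIndex m)

/-- The first two terms carry the base curvature, the `H²` terms come from the radial second
fundamental form, and the `α` terms are O'Neill's correction for a non-integrable horizontal
distribution. -/
lemma adaptedCurvature_hor_hor_hor_hor :
    adaptedCurvature H W H' W' κ' α αr α' (hor i) (hor j) (hor k) (hor l)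
      = κ' j i k l - κ' i j k l
        - H ^ 2 * ((if i = k then 1 else 0) * (if j = l then 1 else 0)
          - (if i = l then 1 else 0) * (if j = k then 1 else 0))
        - 2 * α i j * α k l - α i k * α j l + α i l * α j k := by
  simp [adaptedCurvature, curvatureModel, connectionDerivModel, connectionModel, bracketModel,
    Fintype.sum_sum_type]
  split_ifs <;> ring

/-- The only type of component in which horizontal derivatives of `α` survive, hence the exceptional
case of the theorem. -/
lemma adaptedCurvature_hor_hor_hor_ang :
    adaptedCurvature H W H' W' κ' α αr α' (hor i) (hor j) (hor k) ang
      = α' j i k - α' i j k := by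
  simp [adaptedCurvature, curvatureModel, connectionDerivModel, connectionModel, bracketModel,
    Fintype.sum_sum_type]
  ring

lemma adaptedCurvature_hor_hor_hor_rad :
    adaptedCurvature H W H' W' κ' α αr α' (hor i) (hor j) (hor k) rad = 0 := by
  simp [adaptedCurvature, curvatureModel, connectionDerivModel, connectionModel, bracketModel,
    Fintype.sum_sum_type]

/-- Mixed components are evaluated in an order of the indices for which the radial derivative `αr`
does not enter; the other orders follow from the symmetries. -/
lemma adaptedCurvature_hor_hor_ang_rad (hα : ∀ i j, α j i = -α i j) :
    adaptedCurvature H W H' W' κ' α αr α' (hor i) (hor j) ang rad = 2 * (H - W) * α i j := by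
  simp [adaptedCurvature, curvatureModel, connectionDerivModel, connectionModel, bracketModel,
    Fintype.sum_sum_type]
  rw [hα i j]
  ring

lemma adaptedCurvature_hor_ang_hor_ang :
    adaptedCurvature H W H' W' κ' α αr α' (hor i) ang (hor j) ang
      = (∑ k, α i k * α j k) - if i = j then H * W else 0 := by
  simp [adaptedCurvature, curvatureModel, connectionDerivModel, connectionModel, bracketModel,
    Fintype.sum_sum_type, mul_comm (α j _)]
  split_ifs <;> ring

lemma adaptedCurvature_hor_ang_hor_rad (hα : ∀ i j, α j i = -α i j) :
    adaptedCurvature H W H' W' κ' α αr α' (hor i) ang (hor j) rad = (H - W) * α i j := by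
  simp [adaptedCurvature, curvatureModel, connectionDerivModel, connectionModel, bracketModel,
    Fintype.sum_sum_type]
  rw [hα i j]
  ring

lemma adaptedCurvature_hor_ang_ang_rad :
    adaptedCurvature H W H' W' κ' α αr α' (hor i) ang ang rad = 0 := by
  simp [adaptedCurvature, curvatureModel, connectionDerivModel, connectionModel, bracketModel,
    Fintype.sum_sum_type]

lemma adaptedCurvature_hor_rad_hor_rad :
    adaptedCurvature H W H' W' κ' α αr α' (hor i) rad (hor j) rad
      = if i = j then -(H' + H ^ 2) else 0 := by
  simp [adaptedCurvature, curvatureModel, connectionDerivModel, connectionModel, bracketModel,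
    Fintype.sum_sum_type]
  split_ifs <;> ring

lemma adaptedCurvature_hor_rad_ang_rad :
    adaptedCurvature H W H' W' κ' α αr α' (hor i) rad ang rad = 0 := by
  simp [adaptedCurvature, curvatureModel, connectionDerivModel, connectionModel, bracketModel,
    Fintype.sum_sum_type]

lemma adaptedCurvature_ang_rad_ang_rad :
    adaptedCurvature H W H' W' κ' α αr α' ang rad ang rad = -(W' + W ^ 2) := by
  simp [adaptedCurvature, curvatureModel, connectionDerivModel, connectionModel, bracketModel,
    Fintype.sum_sum_type]
  ring

end Model

namespace IsRegularAt

variable {h v : ℝ → ℝ} {β : CSpace m → CSpace m →L[ℝ] ℝ}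
  {X : BaseIndex m → CSpace m → CSpace m} {q : TotalSpace m}

/-- Commuting base fields have vanishing base connection coefficients at the point, so these
contribute neither quadratic terms nor radial derivatives, only their derivatives along the base.
The additional `1/h` in the horizontal derivatives is the scaling of the frame vector. -/
lemma curvatureCoeff_eq (hq : IsRegularAt h v β X q)
    (hb : ∀ i j, lieBracket ℝ (X i) (X j) q.1 = 0) (a b c d : FrameIndex m) :
    curvatureCoeff (muForm h v β) (adaptedFrame h v β X) q a b c d
      = adaptedCurvature (deriv h q.2.2 / h q.2.2) (deriv v q.2.2 / v q.2.2)
        (deriv (fun r => deriv h r / h r) q.2.2) (deriv (fun r => deriv v r / v r) q.2.2)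
        (fun l i j k => (h q.2.2)⁻¹ ^ 2
          * fderiv ℝ (connectionCoeff (ballMetric (mulI m)) X i j k) q.1 (X l q.1))
        (fun i j => v q.2.2 / (4 * h q.2.2 ^ 2) * angularCoeff β X i j q.1)
        (fun i j => deriv (fun r => v r / (4 * h r ^ 2)) q.2.2 * angularCoeff β X i j q.1)
        (fun l i j => v q.2.2 / (4 * h q.2.2 ^ 3)
          * fderiv ℝ (angularCoeff β X i j) q.1 (X l q.1)) a b c d := by
  have hh := hq.h_pos.ne'
  have b0 (i j k) : bracketCoeff (ballMetric (mulI m)) X i j k q.1 = 0 := by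
    simp [bracketCoeff, hb]
  have k0 (i j k) : connectionCoeff (ballMetric (mulI m)) X i j k q.1 = 0 := by
    simp [connectionCoeff, b0]
  rw [hq.isOrthonormalFrameAt.curvature_frame, adaptedCurvature, curvatureModel]
  simp only [hq.bracketCoeff_eq, hq.connectionCoeff_eq, b0, k0, mul_zero]
  have hD (a b c d) : fderiv ℝ (connectionCoeff (muForm h v β) (adaptedFrame h v β X) b c d) q
      (adaptedFrame h v β X a q) = connectionDerivModel
        (deriv (fun r => deriv h r / h r) q.2.2) (deriv (fun r => deriv v r / v r) q.2.2)
        (fun l i j k => (h q.2.2)⁻¹ ^ 2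
          * fderiv ℝ (connectionCoeff (ballMetric (mulI m)) X i j k) q.1 (X l q.1))
        (fun i j => deriv (fun r => v r / (4 * h r ^ 2)) q.2.2 * angularCoeff β X i j q.1)
        (fun l i j => v q.2.2 / (4 * h q.2.2 ^ 3)
          * fderiv ℝ (angularCoeff β X i j) q.1 (X l q.1)) a b c d := by
    rw [hq.fderiv_connectionCoeff]
    rcases a with i | _ | _
    · have e1 : (adaptedFrame h v β X (hor i) q).1 = (h q.2.2)⁻¹ • X i q.1 := rfl
      have e2 : (adaptedFrame h v β X (hor i) q).2.2 = 0 := by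
        simp [adaptedFrame, horizontalLift]
      simp only [connectionDerivModel, e1, e2, k0, mul_zero, zero_mul, zero_add, map_smul,
        smul_eq_mul]
      congr 1
      · funext i j k
        ring
      · funext i j
        field_simp
    · have e1 : (adaptedFrame h v β X ang q).1 = 0 := by simp [adaptedFrame, dTheta]
      have e2 : (adaptedFrame h v β X ang q).2.2 = 0 := by simp [adaptedFrame, dTheta]
      simp only [connectionDerivModel, e1, e2, k0, mul_zero, zero_mul, zero_add, map_zero]
      rcases b with j | _ | _ <;> rcases c with k | _ | _ <;> rcases d with l | _ | _ <;>
        simp [connectionModel]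
    · have e1 : (adaptedFrame h v β X rad q).1 = 0 := rfl
      have e2 : (adaptedFrame h v β X rad q).2.2 = 1 := rfl
      simp only [connectionDerivModel, e1, e2, k0, mul_zero, mul_one, add_zero, map_zero]
  simp only [hD]

end IsRegularAt

/-! ### The complex structure and the base curvature in a holomorphic frame. -/

/-- The matrix of the complex structure in a frame `X` with `X_{i+1} = J X_i` for `i` odd. -/
def complexEntry (i j : BaseIndex m) : ℝ :=
  if j = (i.1, !i.2) then (if i.2 then -1 else 1) else 0

lemma complexEntry_self (i : BaseIndex m) : complexEntry i i = 0 := by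
  rcases i with ⟨a, s⟩
  cases s <;> simp [complexEntry]

lemma ballMetric_mulI_frame {X : BaseIndex m → CSpace m → CSpace m} {p : CSpace m}
    (hX : IsHolomorphicFrame X p) (hp : ‖p‖ < 1) (i j : BaseIndex m) :
    ballMetric (mulI m) p (mulI m (X i p)) (X j p) = complexEntry i j := by
  have h1 := (hX.isOrthonormalFrameAt hp).apply_eq
  rcases i with ⟨a, s⟩
  cases s
  · rw [mulI_apply, ← hX.holomorphic_pair, h1]
    simp [complexEntry, eq_comm]
  · rw [hX.holomorphic_pair, ← mulI_apply, isHermitianStructure_mulI.apply_apply, map_neg,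
      neg_apply, h1]
    simp only [complexEntry, eq_comm (a := j)]
    split_ifs <;> simp_all

/-- The base curvature computed in two ways: the frame formula reduces at `p` to this difference of
derivatives, and the explicit tensor of the ball gives the right side. The individual derivatives
depend on the frame and are never needed. -/
lemma fderiv_connectionCoeff_sub {X : BaseIndex m → CSpace m → CSpace m} {p : CSpace m}
    (hX : IsHolomorphicFrame X p) (hp : ‖p‖ < 1) (i j k l : BaseIndex m) :
    fderiv ℝ (connectionCoeff (ballMetric (mulI m)) X i k l) p (X j p)
      - fderiv ℝ (connectionCoeff (ballMetric (mulI m)) X j k l) p (X i p)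
      = -((if i = k then 1 else 0) * (if j = l then 1 else 0)
        - (if j = k then 1 else 0) * (if i = l then 1 else 0)
        + complexEntry i k * complexEntry j l - complexEntry j k * complexEntry i l
        + 2 * complexEntry i j * complexEntry k l) := by
  have hY := hX.isOrthonormalFrameAt hp
  have b0 (i j k) : bracketCoeff (ballMetric (mulI m)) X i j k p = 0 := by
    simp [bracketCoeff, hX.lieBracket_eq_zero]
  have k0 (i j k) : connectionCoeff (ballMetric (mulI m)) X i j k p = 0 := by
    simp [connectionCoeff, b0]
  have h1 := hY.curvature_frame i j k l
  have e := ballMetric_mulI_frame hX hp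
  simp only [b0, k0, zero_mul, Finset.sum_const_zero, sub_zero, add_zero, zero_sub] at h1
  rw [curvatureCoeff, curvature_ballMetric isHermitianStructure_mulI hp (hY.differentiableAt i)
    (hY.differentiableAt j) (hY.contDiffAt k)] at h1
  simp only [map_neg, map_add, map_sub, map_smul, neg_apply, add_apply, sub_apply, smul_apply,
    smul_eq_mul, e, hY.apply_eq] at h1
  linarith

/-! ### Index patterns and reduction by the curvature symmetries. -/

namespace FrameIndex

lemma partner_partner (a : FrameIndex m) : partner (partner a) = a := by
  rcases a with ⟨i, s⟩ | s <;> simp [partner]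

lemma eq_partner_comm {a b : FrameIndex m} : a = partner b ↔ b = partner a := by
  constructor <;> rintro rfl <;> rw [partner_partner]

lemma isListed_swap_left {a b c d : FrameIndex m} : IsListed b a c d ↔ IsListed a b c d := by
  simp only [IsListed, eq_partner_comm (a := a) (b := b)]
  tauto

lemma isListed_swap_right {a b c d : FrameIndex m} : IsListed a b d c ↔ IsListed a b c d := by
  simp only [IsListed, eq_partner_comm (a := c) (b := d)]
  tauto

lemma isListed_pair_swap {a b c d : FrameIndex m} : IsListed c d a b ↔ IsListed a b c d := by
  simp only [IsListed, eq_partner_comm (a := a) (b := c), eq_partner_comm (a := b) (b := d),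
    eq_partner_comm (a := a) (b := d), eq_partner_comm (a := b) (b := c), eq_comm (a := a) (b := c),
    eq_comm (a := a) (b := d), eq_comm (a := b) (b := c), eq_comm (a := b) (b := d)]
  tauto

lemma isThreeHorOneAng_swap_left {a b c d : FrameIndex m} :
    IsThreeHorOneAng b a c d ↔ IsThreeHorOneAng a b c d := by
  have h : [b, a, c, d].Perm [a, b, c, d] := List.Perm.swap _ _ _
  simp only [IsThreeHorOneAng, h.count_eq, h.mem_iff]

lemma isThreeHorOneAng_swap_right {a b c d : FrameIndex m} :
    IsThreeHorOneAng a b d c ↔ IsThreeHorOneAng a b c d := by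
  have h : [a, b, d, c].Perm [a, b, c, d] := ((List.Perm.swap _ _ _).cons _).cons _
  simp only [IsThreeHorOneAng, h.count_eq, h.mem_iff]

lemma isThreeHorOneAng_pair_swap {a b c d : FrameIndex m} :
    IsThreeHorOneAng c d a b ↔ IsThreeHorOneAng a b c d := by
  have h : [c, d, a, b].Perm [a, b, c, d] := List.perm_append_comm (l₁ := [c, d]) (l₂ := [a, b])
  simp only [IsThreeHorOneAng, h.count_eq, h.mem_iff]

/-- To prove a symmetric property of unordered pairs of frame indices it suffices to consider pairs
in increasing order. -/
lemma pair_induction {Q : FrameIndex m → FrameIndex m → Prop} (symm : ∀ a b, Q a b → Q b a)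
    (diag : ∀ a, Q a a) (hor_hor : ∀ i j, Q (hor i) (hor j)) (hor_ang : ∀ i, Q (hor i) ang)
    (hor_rad : ∀ i, Q (hor i) rad) (ang_rad : Q ang rad) (a b : FrameIndex m) : Q a b := by
  rcases a with i | _ | _ <;> rcases b with j | _ | _
  · exact hor_hor i j
  · exact hor_ang i
  · exact hor_rad i
  · exact symm _ _ (hor_ang j)
  · exact diag _
  · exact ang_rad
  · exact symm _ _ (hor_rad j)
  · exact symm _ _ ang_rad
  · exact diag _

/-- To prove a property with the symmetries of a curvature tensor, it suffices to consider pairs of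
indices in increasing order. -/
lemma curvature_induction {P : FrameIndex m → FrameIndex m → FrameIndex m → FrameIndex m → Prop}
    (swap_left : ∀ a b c d, P a b c d → P b a c d) (swap_right : ∀ a b c d, P a b c d → P a b d c)
    (pair_swap : ∀ a b c d, P a b c d → P c d a b) (diag : ∀ a c d, P a a c d)
    (hhhh : ∀ i j k l, P (hor i) (hor j) (hor k) (hor l))
    (hhha : ∀ i j k, P (hor i) (hor j) (hor k) ang)
    (hhhr : ∀ i j k, P (hor i) (hor j) (hor k) rad)
    (hhar : ∀ i j, P (hor i) (hor j) ang rad)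
    (haha : ∀ i j, P (hor i) ang (hor j) ang)
    (hahr : ∀ i j, P (hor i) ang (hor j) rad)
    (haar : ∀ i, P (hor i) ang ang rad)
    (hrhr : ∀ i j, P (hor i) rad (hor j) rad)
    (hrar : ∀ i, P (hor i) rad ang rad)
    (arar : P ang rad ang rad) (a b c d : FrameIndex m) : P a b c d := by
  have diag' : ∀ a b c, P a b c c := fun a b c => pair_swap _ _ _ _ (diag c a b)
  have right (a b) := pair_induction (Q := P a b) (swap_right a b) (diag' a b)
  refine pair_induction (Q := fun a b => ∀ c d, P a b c d)
    (fun a b h c d => swap_left _ _ _ _ (h c d)) diag (fun i j => right _ _ (hhhh i j) (hhha i j)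
      (hhhr i j) (hhar i j)) (fun i => right _ _ ?_ (haha i) (hahr i) (haar i))
      (fun i => right _ _ ?_ ?_ (hrhr i) (hrar i)) (right _ _ ?_ ?_ ?_ arar) a b c d
  · exact fun j k => pair_swap _ _ _ _ (hhha j k i)
  · exact fun j k => pair_swap _ _ _ _ (hhhr j k i)
  · exact fun j => pair_swap _ _ _ _ (hahr j i)
  · exact fun j k => pair_swap _ _ _ _ (hhar j k)
  · exact fun j => pair_swap _ _ _ _ (haar j)
  · exact fun j => pair_swap _ _ _ _ (hrar j)

end FrameIndex

/-! ### Structure constants, logarithmic derivatives and vanishing components. -/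

lemma eq_of_complexEntry_ne_zero {i j : BaseIndex m} (h : complexEntry i j ≠ 0) :
    hor j = partner (hor i) := by
  by_contra h'
  refine h ?_
  rw [complexEntry, if_neg]
  rintro rfl
  exact h' rfl

/-- The matrix of `J` is orthogonal. This makes the components with two angular indices diagonal in
the horizontal ones. -/
lemma sum_complexEntry_mul (i j : BaseIndex m) :
    ∑ k, complexEntry i k * complexEntry j k = if i = j then 1 else 0 := by
  simp only [complexEntry, ite_mul, zero_mul, Finset.sum_ite_eq', Finset.mem_univ, if_true]
  rcases i with ⟨a, s⟩
  rcases j with ⟨b, t⟩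
  cases s <;> cases t <;> simp

lemma angularCoeff_eq {β : CSpace m → CSpace m →L[ℝ] ℝ} {X : BaseIndex m → CSpace m → CSpace m}
    {q : TotalSpace m} {c : Fin m → ℝ} (hc : HasStructureConstants β X q c)
    (hβ : DifferentiableAt ℝ β q.1) (hX : ∀ i, DifferentiableAt ℝ (X i) q.1)
    (hb : ∀ i j, lieBracket ℝ (X i) (X j) q.1 = 0) (i j : BaseIndex m) :
    angularCoeff β X i j q.1 = c i.1 * complexEntry i j := by
  have h1 (i j) : (lieBracket ℝ (horizontalLift β (X i)) (horizontalLift β (X j)) q).2.1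
      = angularCoeff β X i j q.1 := by
    rw [lieBracket_horizontalLift hβ (hX i) (hX j), hb]
    simp [angularCoeff]
  have h2 (a) : angularCoeff β X (a, false) (a, true) q.1 = c a := by
    rw [← h1, hc.pair]
    simp [dTheta]
  have h3 (i j : BaseIndex m) (h : i.1 ≠ j.1) : angularCoeff β X i j q.1 = 0 := by
    rw [← h1, hc.not_pair i j h]
    simp
  have h4 (i) : angularCoeff β X i i q.1 = 0 := by simp [angularCoeff]
  rcases i with ⟨a, s⟩
  rcases j with ⟨b, t⟩
  by_cases hab : a = b
  · subst hab
    cases s <;> cases t <;> simp [complexEntry, h2, h4]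
    rw [angularCoeff_swap, h2]
  · rw [h3 _ _ hab]
    simp [complexEntry, Ne.symm hab]

/-- The angular form annihilates the lift of `[X_i, X_j]`, so near `q` it sees exactly
`angularCoeff` at the base point, even where the base fields do not commute. Stationarity then
descends to the base. -/
lemma fderiv_angularCoeff_eq_zero {β : CSpace m → CSpace m →L[ℝ] ℝ}
    {h v : ℝ → ℝ} {X : BaseIndex m → CSpace m → CSpace m} {q : TotalSpace m}
    (hq : IsRegularAt h v β X q) (hs : StructureConstantsStationary β X q) (i j : BaseIndex m) :
    fderiv ℝ (angularCoeff β X i j) q.1 = 0 := by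
  have h1 : (fun x => angularForm β x
      (lieBracket ℝ (horizontalLift β (X i)) (horizontalLift β (X j)) x))
      =ᶠ[𝓝 q] fun x => angularCoeff β X i j x.1 := by
    filter_upwards [hq.eventually] with x hx
    rw [lieBracket_horizontalLift hx.differentiableAt_form (hx.frame.differentiableAt i)
      (hx.frame.differentiableAt j)]
    simp [angularForm, angularCoeff]
  have h2 : HasFDerivAt (fun x : TotalSpace m => angularCoeff β X i j x.1)
      ((fderiv ℝ (angularCoeff β X i j) q.1).comp (ContinuousLinearMap.fst ℝ _ _)) q :=
    (hq.differentiableAt_angularCoeff i j).hasFDerivAt.comp q hasFDerivAt_fst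
  have h3 := h2.unique ((hs i j).congr_of_eventuallyEq h1.symm)
  ext u
  simpa using congrArg (fun T => T (u, 0)) h3

lemma deriv_deriv_div {f : ℝ → ℝ} {r : ℝ} (hf : ContDiffAt ℝ 2 f r) (h0 : f r ≠ 0) :
    deriv (fun s => deriv f s / f s) r = deriv (deriv f) r / f r - (deriv f r / f r) ^ 2 := by
  rw [deriv_fun_div (differentiableAt_deriv hf) (hf.differentiableAt (by simp)) h0]
  field_simp

lemma deriv_log_div {f g : ℝ → ℝ} {r : ℝ} (hf : DifferentiableAt ℝ f r)
    (hg : DifferentiableAt ℝ g r) (hf0 : f r ≠ 0) (hg0 : g r ≠ 0) :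
    deriv (fun s => Real.log (f s / g s)) r = deriv f r / f r - deriv g r / g r := by
  have h1 := (hf.hasDerivAt.div hg.hasDerivAt hg0).log (div_ne_zero hf0 hg0)
  erw [h1.deriv]
  simp only [Pi.div_apply]
  field_simp

/-- A tensor with the symmetries of a curvature tensor whose components have the shape of those of
the adapted frame vanishes on the index patterns that are not listed, under a condition `S` that
takes care of the components with three horizontal indices and one index of `∂/∂θ`. -/
lemma eq_zero_of_not_isListed {F : FrameIndex m → FrameIndex m → FrameIndex m → FrameIndex m → ℝ}
    (symm : ∀ a b k l, F b a k l = -F a b k l ∧ F a b l k = -F a b k l ∧ F k l a b = F a b k l)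
    (hhhh : ∀ i j k l : BaseIndex m, ((if i = k then 1 else 0 : ℝ) * (if j = l then 1 else 0)) = 0 →
      ((if i = l then 1 else 0 : ℝ) * (if j = k then 1 else 0)) = 0 →
      complexEntry i k * complexEntry j l = 0 → complexEntry i l * complexEntry j k = 0 →
      complexEntry i j * complexEntry k l = 0 → F (hor i) (hor j) (hor k) (hor l) = 0)
    (hhhr : ∀ i j k, F (hor i) (hor j) (hor k) rad = 0)
    (hhar : ∀ i j, complexEntry i j = 0 → F (hor i) (hor j) ang rad = 0)
    (haha : ∀ i j, i ≠ j → F (hor i) ang (hor j) ang = 0)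
    (hahr : ∀ i j, complexEntry i j = 0 → F (hor i) ang (hor j) rad = 0)
    (haar : ∀ i, F (hor i) ang ang rad = 0)
    (hrhr : ∀ i j, i ≠ j → F (hor i) rad (hor j) rad = 0)
    (hrar : ∀ i, F (hor i) rad ang rad = 0)
    (S : FrameIndex m → FrameIndex m → FrameIndex m → FrameIndex m → Prop)
    (s1 : ∀ a b k l, S b a k l → S a b k l) (s2 : ∀ a b k l, S a b l k → S a b k l)
    (s3 : ∀ a b k l, S k l a b → S a b k l)
    (hhha : ∀ i j k, S (hor i) (hor j) (hor k) ang → F (hor i) (hor j) (hor k) ang = 0)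
    (a b k l : FrameIndex m) : ¬ IsListed a b k l → S a b k l → F a b k l = 0 := by
  have ne {i j : BaseIndex m} (hij : hor j ≠ partner (hor i)) : complexEntry i j = 0 :=
    by_contra fun h => hij (eq_of_complexEntry_ne_zero h)
  have ne2 {i j k l : BaseIndex m} (h : ¬ (hor j = partner (hor i) ∧ hor l = partner (hor k))) :
      complexEntry i j * complexEntry k l = 0 :=
    by_contra fun h' => h ⟨eq_of_complexEntry_ne_zero (left_ne_zero_of_mul h'),
      eq_of_complexEntry_ne_zero (right_ne_zero_of_mul h')⟩
  have delta {i j k l : BaseIndex m} (h : ¬ (hor j = hor i ∧ hor l = hor k)) :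
      ((if i = j then 1 else 0 : ℝ) * (if k = l then 1 else 0)) = 0 := by
    by_contra h'
    refine h ⟨?_, ?_⟩
    · by_contra h1
      exact h' (by rw [if_neg fun e : i = j => h1 (congrArg Sum.inl e.symm), zero_mul])
    · by_contra h1
      exact h' (by rw [if_neg fun e : k = l => h1 (congrArg Sum.inl e.symm), mul_zero])
  revert a b k l
  refine curvature_induction (fun a b k l H hL hS => ?_) (fun a b k l H hL hS => ?_)
    (fun a b k l H hL hS => ?_) (fun a k l _ _ => ?_) (fun i j k l hL _ => ?_)
    (fun i j k _ => hhha i j k) (fun i j k _ _ => hhhr i j k) (fun i j hL _ => ?_)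
    (fun i j hL _ => ?_) (fun i j hL _ => ?_) (fun i _ _ => haar i) (fun i j hL _ => ?_)
    (fun i _ _ => hrar i) (fun hL _ => ?_)
  · rw [(symm a b k l).1, H (by rwa [isListed_swap_left] at hL) (s1 _ _ _ _ hS), neg_zero]
  · rw [(symm a b k l).2.1, H (by rwa [isListed_swap_right] at hL) (s2 _ _ _ _ hS), neg_zero]
  · rw [(symm a b k l).2.2, H (by rwa [isListed_pair_swap] at hL) (s3 _ _ _ _ hS)]
  -- Skewness in the first pair makes the component equal to its own negative.
  · linarith [(symm a a k l).1]
  · exact hhhh i j k l (delta fun h => hL (Or.inl h))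
      (delta fun h => hL (Or.inr (Or.inl ⟨h.2, h.1⟩)))
      (ne2 fun h => hL (Or.inr (Or.inr (Or.inr (Or.inl h)))))
      (ne2 fun h => hL (Or.inr (Or.inr (Or.inr (Or.inr h)))))
      (ne2 fun h => hL (Or.inr (Or.inr (Or.inl h))))
  · exact hhar i j (ne fun h => hL (Or.inr (Or.inr (Or.inl ⟨h, rfl⟩))))
  · refine haha i j ?_
    rintro rfl
    exact hL (Or.inl ⟨rfl, rfl⟩)
  · exact hahr i j (ne fun h => hL (Or.inr (Or.inr (Or.inr (Or.inl ⟨h, rfl⟩)))))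
  · refine hrhr i j ?_
    rintro rfl
    exact hL (Or.inl ⟨rfl, rfl⟩)
  -- The angular-radial sectional curvature is always a listed pattern.
  · exact absurd (Or.inl ⟨rfl, rfl⟩) hL

/-! ### The main theorem. -/

open FrameIndex in
theorem theorem2p2 (m : ℕ) (h v : ℝ → ℝ)
    (hh : ContDiffOn ℝ ∞ h (Set.Ioi 0)) (hv : ContDiffOn ℝ ∞ v (Set.Ioi 0))
    (hpos : ∀ r, 0 < r → 0 < h r) (vpos : ∀ r, 0 < r → 0 < v r)
    (p : CSpace m) (hp : ‖p‖ < 1) (θ r : ℝ) (hr : 0 < r)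
    (β : CSpace m → CSpace m →L[ℝ] ℝ) (hβ : ContDiffAt ℝ ∞ β p)
    (X : BaseIndex m → CSpace m → CSpace m) (hX : IsHolomorphicFrame X p)
    (c : Fin m → ℝ) (hc : HasStructureConstants β X (p, θ, r) c) :
    -- `Y` is an orthonormal basis
    (∀ a b : FrameIndex m, muMetric h v β (p, θ, r)
      (adaptedFrame h v β X a (p, θ, r)) (adaptedFrame h v β X b (p, θ, r))
        = if a = b then 1 else 0) ∧
    -- symmetries of the curvature tensor
    (∀ a b k l : FrameIndex m,
      curvComp h v β X (p, θ, r) b a k l = -curvComp h v β X (p, θ, r) a b k l ∧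
      curvComp h v β X (p, θ, r) a b l k = -curvComp h v β X (p, θ, r) a b k l ∧
      curvComp h v β X (p, θ, r) k l a b = curvComp h v β X (p, θ, r) a b k l) ∧
    -- sectional curvatures of the coordinate planes
    (∀ i j : BaseIndex m, i.1 ≠ j.1 →
      curvComp h v β X (p, θ, r) (hor i) (hor j) (hor i) (hor j)
        = -(1 / h r ^ 2) - (deriv h r / h r) ^ 2) ∧
    (∀ i : BaseIndex m,
      curvComp h v β X (p, θ, r) (hor i) ang (hor i) ang
        = -(deriv h r * deriv v r / (h r * v r)) + c i.1 ^ 2 * v r ^ 2 / (16 * h r ^ 4)) ∧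
    (∀ a : Fin m,
      curvComp h v β X (p, θ, r) (odd a) (even a) (odd a) (even a)
        = -(deriv h r / h r) ^ 2 - 4 / h r ^ 2 - 3 * c a ^ 2 * v r ^ 2 / (16 * h r ^ 4)) ∧
    (∀ i : BaseIndex m,
      curvComp h v β X (p, θ, r) (hor i) rad (hor i) rad = -(deriv (deriv h) r / h r)) ∧
    curvComp h v β X (p, θ, r) ang rad ang rad = -(deriv (deriv v) r / v r) ∧
    -- mixed terms
    (∀ a : Fin m,
      curvComp h v β X (p, θ, r) (odd a) (even a) ang rad
        = -c a * (v r / (2 * h r ^ 2)) * deriv (fun s => Real.log (v s / h s)) r ∧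
      2 * curvComp h v β X (p, θ, r) (odd a) ang (even a) rad
        = -c a * (v r / (2 * h r ^ 2)) * deriv (fun s => Real.log (v s / h s)) r ∧
      -2 * curvComp h v β X (p, θ, r) (odd a) rad (even a) ang
        = -c a * (v r / (2 * h r ^ 2)) * deriv (fun s => Real.log (v s / h s)) r) ∧
    (∀ a b : Fin m, a ≠ b →
      curvComp h v β X (p, θ, r) (odd a) (even a) (odd b) (even b)
        = -(2 / h r ^ 2) - c a * c b * v r ^ 2 / (8 * h r ^ 4) ∧
      2 * curvComp h v β X (p, θ, r) (odd a) (odd b) (even a) (even b)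
        = -(2 / h r ^ 2) - c a * c b * v r ^ 2 / (8 * h r ^ 4) ∧
      -2 * curvComp h v β X (p, θ, r) (odd a) (even b) (even a) (odd b)
        = -(2 / h r ^ 2) - c a * c b * v r ^ 2 / (8 * h r ^ 4)) ∧
    -- all other components vanish
    (∀ a b k l : FrameIndex m, ¬ IsListed a b k l → ¬ IsThreeHorOneAng a b k l →
      curvComp h v β X (p, θ, r) a b k l = 0) ∧
    (StructureConstantsStationary β X (p, θ, r) →
      ∀ a b k l : FrameIndex m, ¬ IsListed a b k l →
        curvComp h v β X (p, θ, r) a b k l = 0) := by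
  have two_le : (2 : ℕ∞ω) ≤ ∞ := WithTop.coe_le_coe.2 le_top
  have hq : IsRegularAt h v β X (p, θ, r) :=
    { norm_lt := hp
      h_pos := hpos r hr
      v_pos := vpos r hr
      contDiffAt_h := (hh.contDiffAt (Ioi_mem_nhds hr)).of_le two_le
      contDiffAt_v := (hv.contDiffAt (Ioi_mem_nhds hr)).of_le two_le
      contDiffAt_form := hβ.of_le two_le
      frame := hX.isOrthonormalFrameAt hp }
  have h0 : h r ≠ 0 := hq.h_pos.ne'
  have v0 : v r ≠ 0 := hq.v_pos.ne'
  have hY := hq.isOrthonormalFrameAt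
  have hα := angularCoeff_eq hc hq.differentiableAt_form hq.frame.differentiableAt
    hX.lieBracket_eq_zero
  -- Skewness is inherited from `angularCoeff`, which avoids a case distinction on indices.
  have hα_swap (i j : BaseIndex m) : v r / (4 * h r ^ 2) * (c j.1 * complexEntry j i)
      = -(v r / (4 * h r ^ 2) * (c i.1 * complexEntry i j)) := by
    rw [← hα, ← hα, angularCoeff_swap, mul_neg]
  have dH := deriv_deriv_div hq.contDiffAt_h h0
  have dW := deriv_deriv_div hq.contDiffAt_v v0
  have dlog := deriv_log_div (hq.contDiffAt_v.differentiableAt (by simp))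
    (hq.contDiffAt_h.differentiableAt (by simp)) v0 h0
  have κ := fderiv_connectionCoeff_sub hX hp
  have R := hq.curvatureCoeff_eq hX.lieBracket_eq_zero
  simp only at R hα dH dW dlog
  simp only [hα] at R
  -- One closed formula for all horizontal components; the listed values are specializations of it.
  -- The coefficient `v²/(16h⁴)` is the square of the `v/(4h²)` in `α`.
  have hhhh (i j k l : BaseIndex m) :
      curvComp h v β X (p, θ, r) (hor i) (hor j) (hor k) (hor l)
        = -(1 / h r ^ 2 + (deriv h r / h r) ^ 2) * ((if i = k then 1 else 0) *
            (if j = l then 1 else 0) - (if i = l then 1 else 0) * (if j = k then 1 else 0))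
          - (1 / h r ^ 2 + c i.1 * c j.1 * v r ^ 2 / (16 * h r ^ 4)) *
            (complexEntry i k * complexEntry j l - complexEntry i l * complexEntry j k)
          - 2 * (1 / h r ^ 2 + c i.1 * c k.1 * v r ^ 2 / (16 * h r ^ 4)) *
            (complexEntry i j * complexEntry k l) := by
    rw [curvComp_eq, R, adaptedCurvature_hor_hor_hor_hor, ← mul_sub, κ]
    field_simp
    ring
  have hhhr (i j k : BaseIndex m) :
      curvComp h v β X (p, θ, r) (hor i) (hor j) (hor k) rad = 0 := by
    rw [curvComp_eq, R, adaptedCurvature_hor_hor_hor_rad]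
  have hhar (i j : BaseIndex m) :
      curvComp h v β X (p, θ, r) (hor i) (hor j) ang rad
        = -(c i.1 * complexEntry i j) * (v r / (2 * h r ^ 2))
          * deriv (fun s => Real.log (v s / h s)) r := by
    rw [curvComp_eq, R, adaptedCurvature_hor_hor_ang_rad (hα := hα_swap), dlog]
    ring
  have haha (i j : BaseIndex m) :
      curvComp h v β X (p, θ, r) (hor i) ang (hor j) ang
        = if i = j then -(deriv h r * deriv v r / (h r * v r))
            + c i.1 ^ 2 * v r ^ 2 / (16 * h r ^ 4) else 0 := by
    rw [curvComp_eq, R, adaptedCurvature_hor_ang_hor_ang]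
    -- Orthogonality of the rows of `J` collapses the sum over intermediate indices.
    have e : ∑ k, v r / (4 * h r ^ 2) * (c i.1 * complexEntry i k)
          * (v r / (4 * h r ^ 2) * (c j.1 * complexEntry j k))
        = (v r / (4 * h r ^ 2)) ^ 2 * (c i.1 * c j.1) * if i = j then 1 else 0 := by
      rw [← sum_complexEntry_mul, Finset.mul_sum]
      exact Finset.sum_congr rfl fun k _ => by ring
    rw [e]
    split_ifs with hij
    · subst hij
      field_simp
      ring
    · simp
  have hahr (i j : BaseIndex m) :
      2 * curvComp h v β X (p, θ, r) (hor i) ang (hor j) rad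
        = -(c i.1 * complexEntry i j) * (v r / (2 * h r ^ 2))
          * deriv (fun s => Real.log (v s / h s)) r := by
    rw [curvComp_eq, R, adaptedCurvature_hor_ang_hor_rad (hα := hα_swap), dlog]
    ring
  have haar (i : BaseIndex m) : curvComp h v β X (p, θ, r) (hor i) ang ang rad = 0 := by
    rw [curvComp_eq, R, adaptedCurvature_hor_ang_ang_rad]
  have hrhr (i j : BaseIndex m) : curvComp h v β X (p, θ, r) (hor i) rad (hor j) rad
      = if i = j then -(deriv (deriv h) r / h r) else 0 := by
    rw [curvComp_eq, R, adaptedCurvature_hor_rad_hor_rad, dH]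
    ring_nf
  have hrar (i : BaseIndex m) : curvComp h v β X (p, θ, r) (hor i) rad ang rad = 0 := by
    rw [curvComp_eq, R, adaptedCurvature_hor_rad_ang_rad]
  have arar : curvComp h v β X (p, θ, r) ang rad ang rad = -(deriv (deriv v) r / v r) := by
    rw [curvComp_eq, R, adaptedCurvature_ang_rad_ang_rad, dW]
    ring
  have symm (a b k l : FrameIndex m) :
      curvComp h v β X (p, θ, r) b a k l = -curvComp h v β X (p, θ, r) a b k l ∧
      curvComp h v β X (p, θ, r) a b l k = -curvComp h v β X (p, θ, r) a b k l ∧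
      curvComp h v β X (p, θ, r) k l a b = curvComp h v β X (p, θ, r) a b k l := by
    simp only [curvComp_eq]
    exact ⟨hY.curvatureCoeff_swap_left a b k l, hY.curvatureCoeff_swap_right a b k l,
      hY.curvatureCoeff_pair_swap a b k l⟩
  have vanish := eq_zero_of_not_isListed symm
    (fun i j k l z1 z2 z3 z4 z5 => by rw [hhhh, z1, z2, z3, z4, z5]; simp) hhhr
    (fun i j z => by rw [hhar, z]; simp) (fun i j z => by rw [haha, if_neg z])
    (fun i j z => by have := hahr i j; rw [z] at this; simpa using this) haar
    (fun i j z => by rw [hrhr, if_neg z]) hrar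
  refine ⟨fun a b => ?_, symm, fun i j hij => ?_, fun i => ?_, fun a => ?_, fun i => ?_, arar,
    fun a => ⟨?_, ?_, ?_⟩, fun a b hab => ⟨?_, ?_, ?_⟩, fun a b k l hL hT => ?_,
    fun hS a b k l hL => ?_⟩
  · rw [muMetric_eq_formOf]
    exact hq.muForm_adaptedFrame a b
  · rw [hhhh]
    have n1 : i ≠ j := fun h => hij (h ▸ rfl)
    have n2 : complexEntry i j = 0 := by
      rw [complexEntry, if_neg]
      rintro rfl
      exact hij rfl
    simp [n1, n2, complexEntry_self]
    ring
  · simp [haha]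
  · rw [hhhh]
    simp [complexEntry]
    field_simp
    ring
  · simp [hrhr]
  · simp [hhar, complexEntry]
  · simp [hahr, complexEntry]
  -- Pair symmetry puts the angular index first, with even and odd exchanged; the entry of `J` is
  -- then `-1`, which accounts for the sign.
  · rw [← (symm _ _ _ _).2.2, neg_mul, hahr]
    simp [complexEntry]
  · rw [hhhh]
    simp [complexEntry, hab, hab.symm]
    field_simp
    ring
  · rw [hhhh]
    simp [complexEntry, hab, hab.symm]
    field_simp
    ring
  · rw [hhhh]
    simp [complexEntry, hab, hab.symm]
    field_simp
    ring
  -- Here the side condition excludes the exceptional components, so their case is contradictory.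
  · refine vanish (fun a b k l => ¬ IsThreeHorOneAng a b k l) (fun a b k l h => ?_)
      (fun a b k l h => ?_) (fun a b k l h => ?_) (fun i j k h => ?_) a b k l hL hT
    · rwa [isThreeHorOneAng_swap_left] at h
    · rwa [isThreeHorOneAng_swap_right] at h
    · rwa [isThreeHorOneAng_pair_swap] at h
    · exact absurd ⟨rfl, by simp⟩ h
  -- Here there is no side condition: the exceptional components are differences of derivatives of
  -- `α`, which vanish by stationarity.
  · refine vanish (fun _ _ _ _ => True) (fun _ _ _ _ h => h) (fun _ _ _ _ h => h)
      (fun _ _ _ _ h => h) (fun i j k _ => ?_) a b k l hL trivial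
    rw [curvComp_eq, R, adaptedCurvature_hor_hor_hor_ang]
    simp [fderiv_angularCoeff_eq_zero hq hS]

end
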